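/- Let $d\ge 1$, $\mathbb T^d=\mathbb R^d/2\pi\mathbb Z^d$ and $S\mathbb T^d=\mathbb T^d\times\mathbb S^{d-1}$, with the Liouville measure $dL=dx\otimes d\mathrm{Vol}(\theta)$. Let $V=\theta\cdot\partial_x$ be the geodesic vector field, with flow $e^{tV}(x,\theta)=(x+t\theta,\theta)$, and let $e^{-tV*}\varphi=\varphi\circ e^{-tV}$. Let $\mathcal D'(S\mathbb T^d)$ be the space of continuous linear forms on $\mathcal C^\infty(S\mathbb T^d)$; a function $f$ is identified with the distribution $\psi\mapsto\langle f,\psi\rangle=\int f\psi\,dL$. Let $\mathrm{Sp}(\sqrt{-\Delta})$ be the set of $\lambda\ge 0$ such that $\lambda^2$ is an eigenvalue of $-\Delta=-\sum_j\partial_{x_j}^2$ on $\mathbb T^d$, and $\mathrm{Sp}(-\sqrt{-\Delta})=-\mathrm{Sp}(\sqrt{-\Delta})$. For $\mathrm{Re}(s)>0$ the operator $$\mathcal L(s)=(V+s)^{-1}=\int_0^\infty e^{-st}e^{-tV*}\,dt:\ \mathcal C^\infty(S\mathbb T^d)\to\mathcal D'(S\mathbb T^d)$$ is well defined: for all $\varphi,\psi\in\mathcal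 C^\infty(S\mathbb T^d)$ the integral $\langle\mathcal L(s)\varphi,\psi\rangle=\int_0^\infty e^{-st}\langle e^{-tV*}\varphi,\psi\rangle\,dt$ converges absolutely, $\mathcal L(s)\varphi$ is a distribution, and $\mathcal L(s)(V+s)\varphi=\varphi=(V+s)\mathcal L(s)\varphi$ in $\mathcal D'(S\mathbb T^d)$. Moreover $s\mapsto\mathcal L(s)$ extends as a $\mathcal C^\infty$ function, with values in the linear maps $\mathcal C^\infty(S\mathbb T^d)\to\mathcal D'(S\mathbb T^d)$, to $$\Omega=\{\mathrm{Re}(s)\ge 0\}\setminus\left(i\,\mathrm{Sp}(\sqrt{-\Delta})\cup i\,\mathrm{Sp}(-\sqrt{-\Delta})\right).$$ That is, for all $\varphi,\psi$ the function $s\mapsto\langle\mathcal L(s)\varphi,\psi\rangle$ is $\mathcal C^\infty$ (in the real sense, up to the boundary points in $\Omega$) on $\Omega$, and for every compact $K\subset\Omega$ and every $k\in\mathbb N$ there are $N,C$ such that its derivatives of order $k$ are bounded on $K$ by $C\|\varphi\|_{\mathcal C^N}\|\psi\|_{\mathcal C^N}$ for all $\varphi,\psi\in\mathcal C^\infty(S\mathbb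 T^d)$. -/

import Mathlib

open scoped Manifold ContDiff NNReal ENNReal

noncomputable section

namespace FlatTorus

/-- Euclidean space `ℝ^d`. -/
abbrev E (d : ℕ) : Type := EuclideanSpace ℝ (Fin d)

/-- The circle `ℝ / 2πℤ` has positive length. -/
instance instFactTwoPi : Fact (0 < 2 * Real.pi) := ⟨Real.two_pi_pos⟩

/-- The flat torus `𝕋^d = ℝ^d / 2πℤ^d`, written as a product of `d` circles `ℝ / 2πℤ`. -/
abbrev Torus (d : ℕ) : Type := Fin d → AddCircle (2 * Real.pi)

/-- The canonical projection `ℝ^d → 𝕋^d`. -/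
def proj {d : ℕ} (x : E d) : Torus d := fun j => (x j : AddCircle (2 * Real.pi))

/-- The unit sphere `S^{d-1}` of `ℝ^d`. -/
abbrev Sph (d : ℕ) : Type := Metric.sphere (0 : E d) 1

/-- For `d ≥ 1`, Mathlib's manifold structure on the sphere applies to `S^{d-1} ⊆ ℝ^d`. -/
instance instFactFinrank (d : ℕ) [NeZero d] :
    Fact (Module.finrank ℝ (E d) = (d - 1) + 1) :=
  ⟨by rw [finrank_euclideanSpace_fin]; have := NeZero.pos d; omega⟩

/-- The unit tangent bundle `S𝕋^d = 𝕋^d × S^{d-1}`. -/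
abbrev UnitBundle (d : ℕ) : Type := Torus d × Sph d

/-- The Liouville measure `dx ⊗ dVol(θ)` on `S𝕋^d`: here `dx` has total mass `(2π)^d` and `dVol`
is the Riemannian surface measure of the unit sphere. -/
def liouville (d : ℕ) : MeasureTheory.Measure (UnitBundle d) :=
  (MeasureTheory.volume : MeasureTheory.Measure (Torus d)).prod
    (MeasureTheory.volume : MeasureTheory.Measure (E d)).toSphere

/-- The lift to `ℝ^d × S^{d-1}` of a function on `S𝕋^d`. -/
def lift {d : ℕ} (f : UnitBundle d → ℂ) (p : E d × Sph d) : ℂ := f (proj p.1, p.2)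

/-- The space `C^∞(S𝕋^d)` of smooth complex functions on `S𝕋^d`: those functions whose lift to the
covering manifold `ℝ^d × S^{d-1}` is smooth. -/
def smoothFn (d : ℕ) [NeZero d] : Submodule ℂ (UnitBundle d → ℂ) where
  carrier := {f | ContMDiff (𝓘(ℝ, E d).prod (𝓡 (d - 1))) 𝓘(ℝ, ℂ) ∞ (lift f)}
  add_mem' {f g} hf hg := by
    have h : lift (f + g) = lift f + lift g := rfl
    simp only [Set.mem_ofPred_eq] at *
    rw [h]
    exact hf.add hg
  zero_mem' := by
    have h : lift (0 : UnitBundle d → ℂ) = fun _ => 0 := rfl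
    simp only [Set.mem_ofPred_eq]
    rw [h]
    exact contMDiff_const
  smul_mem' c f hf := by
    have h : lift (c • f) = fun p => (c • ContinuousLinearMap.id ℝ ℂ) (lift f p) := rfl
    simp only [Set.mem_ofPred_eq] at *
    rw [h]
    exact (c • ContinuousLinearMap.id ℝ ℂ).contDiff.contMDiff.comp hf

/-- `C^∞(S𝕋^d)` as a type. -/
abbrev SmoothFn (d : ℕ) [NeZero d] : Type := ↥(smoothFn d)

/-- The geodesic flow `e^{tV}(x, θ) = (x + tθ, θ)`. -/
def flow {d : ℕ} (t : ℝ) (p : UnitBundle d) : UnitBundle d := (p.1 + proj (t • (p.2 : E d)), p.2)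

theorem proj_add {d : ℕ} (x y : E d) : proj (x + y) = proj x + proj y := by
  funext j
  simp [proj]

theorem contMDiff_lift_flow {d : ℕ} [NeZero d] {f : UnitBundle d → ℂ} (hf : f ∈ smoothFn d) :
    ContMDiff ((𝓘(ℝ, E d).prod (𝓡 (d - 1))).prod 𝓘(ℝ, ℝ)) 𝓘(ℝ, ℂ) ∞
      (fun q : (E d × Sph d) × ℝ => f (flow q.2 (proj q.1.1, q.1.2))) := by
  have h : (fun q : (E d × Sph d) × ℝ => f (flow q.2 (proj q.1.1, q.1.2))) =
      lift f ∘ fun q : (E d × Sph d) × ℝ => (q.1.1 + q.2 • (q.1.2 : E d), q.1.2) := by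
    funext q
    simp [lift, flow, proj_add]
  rw [h]
  refine ContMDiff.comp hf (ContMDiff.prodMk ?_ (contMDiff_snd.comp contMDiff_fst))
  refine (contMDiff_fst.comp contMDiff_fst).add (contMDiff_snd.smul ?_)
  exact contMDiff_coe_sphere.comp (contMDiff_snd.comp contMDiff_fst)

/-- The transport operator `e^{-tV*}` on `C^∞(S𝕋^d)`, that is `φ ↦ φ ∘ e^{-tV}`. -/
def transport {d : ℕ} [NeZero d] (t : ℝ) (φ : SmoothFn d) : SmoothFn d :=
  ⟨fun p => φ.1 (flow (-t) p), by
    have h := (contMDiff_lift_flow φ.2).comp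
      (contMDiff_id.prodMk (contMDiff_const (c := -t)) :
        ContMDiff (𝓘(ℝ, E d).prod (𝓡 (d - 1)))
          ((𝓘(ℝ, E d).prod (𝓡 (d - 1))).prod 𝓘(ℝ, ℝ)) ∞ fun p : E d × Sph d => (p, -t))
    exact h⟩

/-- The geodesic vector field `V = θ · ∂_x`, acting on `C^∞(S𝕋^d)` as the derivative along the
geodesic flow. -/
def geodesicV {d : ℕ} [NeZero d] (φ : SmoothFn d) : SmoothFn d :=
  ⟨fun p => deriv (fun t : ℝ => φ.1 (flow t p)) 0, by
    intro p₀
    have h := ContMDiffAt.mfderiv (m := ∞) (n := ∞)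
      (fun (p : E d × Sph d) (t : ℝ) => φ.1 (flow t (proj p.1, p.2))) (fun _ => (0 : ℝ))
      (contMDiff_lift_flow φ.2 (p₀, 0)) contMDiffAt_const (by simp)
    have e := inTangentCoordinates_model_space (I := 𝓘(ℝ, ℝ)) (I' := 𝓘(ℝ, ℂ))
      (fun _ : E d × Sph d => (0 : ℝ)) (fun p : E d × Sph d => φ.1 (flow 0 (proj p.1, p.2)))
      (fun p => fderiv ℝ (fun t : ℝ => φ.1 (flow t (proj p.1, p.2))) 0) p₀
    have h1 : ContMDiffAt (𝓘(ℝ, E d).prod (𝓡 (d - 1))) 𝓘(ℝ, ℝ →L[ℝ] ℂ) ∞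
        (fun p : E d × Sph d => fderiv ℝ (fun t : ℝ => φ.1 (flow t (proj p.1, p.2))) 0) p₀ := by
      rw [← e]
      simp only [← mfderiv_eq_fderiv]
      exact h
    refine (h1.clm_apply (contMDiffAt_const (c := (1 : ℝ)))).congr_of_eventuallyEq
      (Filter.Eventually.of_forall fun p => ?_)
    exact (fderiv_apply_one_eq_deriv).symm⟩

/-- The duality pairing `∫ f g dL` of two functions on `S𝕋^d`. -/
def pairing {d : ℕ} (f g : UnitBundle d → ℂ) : ℂ := ∫ p, f p * g p ∂(liouville d)

/-- The extension of (the lift of) a function on `S𝕋^d` to `ℝ^d × ℝ^d` that is constant on rays: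
`(x, v) ↦ f (x, v / ‖v‖)` for `v ≠ 0` (and `0` for `v = 0`, a value that is never used). -/
def rayExt {d : ℕ} (f : UnitBundle d → ℂ) (q : E d × E d) : ℂ :=
  if h : q.2 = 0 then 0
  else f (proj q.1, ⟨(‖q.2‖)⁻¹ • q.2, by simp [norm_smul, h]⟩)

/-- The `C^N` norm on functions on `S𝕋^d`: the supremum, over all `j ≤ N` and all points `(x, θ)`,
of the norm of the `j`-th derivative at `(x, θ)` of the extension that is constant on rays. It is
finite on `C^∞(S𝕋^d)`, see `ckNorm_lt_top`, and these norms define the Fréchet topology of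
`C^∞(S𝕋^d)`. -/
def ckNorm {d : ℕ} (N : ℕ) (f : UnitBundle d → ℂ) : ℝ≥0∞ :=
  ⨆ (j : ℕ) (_ : j ≤ N) (x : E d) (θ : Sph d), ‖iteratedFDeriv ℝ j (rayExt f) (x, (θ : E d))‖ₑ

theorem ckNorm_mono {d : ℕ} {M N : ℕ} (h : M ≤ N) (f : UnitBundle d → ℂ) :
    ckNorm M f ≤ ckNorm N f :=
  iSup_mono fun _ => iSup_mono' fun hj => ⟨hj.trans h, le_rfl⟩

theorem contDiffAt_rayExt {d : ℕ} [NeZero d] (φ : SmoothFn d) (q : E d × E d) (hq : q.2 ≠ 0) :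
    ContDiffAt ℝ ∞ (rayExt φ.1) q := by
  let U : TopologicalSpace.Opens (E d × E d) :=
    ⟨{q | q.2 ≠ 0}, isOpen_ne_fun continuous_snd continuous_const⟩
  have key : ContMDiff 𝓘(ℝ, E d × E d) 𝓘(ℝ, ℂ) ∞ (fun u : U => rayExt φ.1 (u : E d × E d)) := by
    have hv : ContMDiff 𝓘(ℝ, E d × E d) 𝓘(ℝ, E d) ∞
        (fun u : U => (‖(u : E d × E d).2‖)⁻¹ • (u : E d × E d).2) := by
      intro u
      refine (contMDiffAt_subtype_iff (U := U)
        (f := fun q : E d × E d => (‖q.2‖)⁻¹ • q.2)).mpr ?_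
      refine ContDiffAt.contMDiffAt ?_
      exact ((contDiffAt_snd.norm ℝ u.2).inv (norm_ne_zero_iff.mpr u.2)).smul contDiffAt_snd
    have hs := hv.codRestrict_sphere (n := d - 1) (fun u => by
      have := u.2
      simp only [mem_sphere_iff_norm, sub_zero, norm_smul, norm_inv, norm_norm]
      exact inv_mul_cancel₀ (norm_ne_zero_iff.mpr this))
    have hx : ContMDiff 𝓘(ℝ, E d × E d) 𝓘(ℝ, E d) ∞ (fun u : U => (u : E d × E d).1) :=
      contDiff_fst.contMDiff.comp contMDiff_subtype_val
    have h := ContMDiff.comp φ.2 (hx.prodMk hs)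
    convert h using 1
    funext u
    have hu : (u : E d × E d).2 ≠ 0 := u.2
    simp [rayExt, lift, hu, Set.codRestrict]
  have h := (contMDiffAt_subtype_iff (U := U) (x := ⟨q, hq⟩)).mp (key ⟨q, hq⟩)
  exact h.contDiffAt

theorem rayExt_periodic {d : ℕ} (f : UnitBundle d → ℂ) (a : E d) (ha : (proj a : Torus d) = 0)
    (q : E d × E d) : rayExt f (q + (a, 0)) = rayExt f q := by
  unfold rayExt
  simp only [Prod.snd_add, Prod.fst_add, add_zero, proj_add, ha]

theorem ckNorm_lt_top {d : ℕ} [NeZero d] (N : ℕ) (φ : SmoothFn d) : ckNorm N φ.1 < ⊤ := by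
  have hj : ∀ j : ℕ, ∃ C : ℝ, ∀ (x : E d) (θ : Sph d),
      ‖iteratedFDeriv ℝ j (rayExt φ.1) (x, (θ : E d))‖ ≤ C := by
    intro j
    have hK : IsCompact (Metric.closedBall (0 : E d) (2 * Real.pi * d) ×ˢ
        Metric.sphere (0 : E d) 1) :=
      (isCompact_closedBall _ _).prod (isCompact_sphere _ _)
    have hc : ContinuousOn (fun q => iteratedFDeriv ℝ j (rayExt φ.1) q)
        (Metric.closedBall (0 : E d) (2 * Real.pi * d) ×ˢ Metric.sphere (0 : E d) 1) := by
      intro q hq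
      have hq2 : q.2 ≠ 0 := by
        have := hq.2
        intro h0
        simp [h0] at this
      exact ((contDiffAt_rayExt φ q hq2).continuousAt_iteratedFDeriv
        (mod_cast le_top)).continuousWithinAt
    obtain ⟨C, hC⟩ := hK.exists_bound_of_continuousOn hc
    refine ⟨C, fun x θ => ?_⟩
    let a : E d := WithLp.toLp 2 fun i => -(⌊x i / (2 * Real.pi)⌋ * (2 * Real.pi))
    have ha : (proj a : Torus d) = 0 := by
      funext i
      simp only [proj, Pi.zero_apply, a]
      rw [AddCircle.coe_eq_zero_iff]
      exact ⟨-⌊x i / (2 * Real.pi)⌋, by simp⟩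
    have hshift : iteratedFDeriv ℝ j (rayExt φ.1) (x, (θ : E d)) =
        iteratedFDeriv ℝ j (rayExt φ.1) (x + a, (θ : E d)) := by
      have h1 : (fun q => rayExt φ.1 (q + (a, 0))) = rayExt φ.1 :=
        funext fun q => rayExt_periodic φ.1 a ha q
      have h2 := iteratedFDeriv_comp_add_right (𝕜 := ℝ) (f := rayExt φ.1) j
        ((a, 0) : E d × E d)
      rw [h1] at h2
      simpa using h2 (x, (θ : E d))
    rw [hshift]
    refine hC _ ⟨?_, θ.2⟩
    rw [mem_closedBall_zero_iff]
    have hcoord : ∀ i, ‖(x + a) i‖ ≤ 2 * Real.pi := by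
      intro i
      have hpi := Real.two_pi_pos
      have h1 := Int.floor_le (x i / (2 * Real.pi))
      have h2 := Int.lt_floor_add_one (x i / (2 * Real.pi))
      rw [le_div_iff₀ hpi] at h1
      rw [div_lt_iff₀ hpi] at h2
      simp only [PiLp.add_apply, a, Real.norm_eq_abs]
      rw [abs_le]
      constructor <;> nlinarith
    calc ‖x + a‖ ≤ ∑ i, ‖(x + a) i‖ := by
          conv_lhs => rw [← (EuclideanSpace.basisFun (Fin d) ℝ).sum_repr (x + a)]
          refine (norm_sum_le _ _).trans (Finset.sum_le_sum fun i _ => ?_)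
          rw [norm_smul]
          simp
      _ ≤ ∑ _i : Fin d, 2 * Real.pi := Finset.sum_le_sum fun i _ => hcoord i
      _ = 2 * Real.pi * d := by simp [mul_comm]
  choose C hC using hj
  refine lt_of_le_of_lt (b := ENNReal.ofReal (∑ j ∈ Finset.range (N + 1), |C j|)) ?_
    ENNReal.ofReal_lt_top
  refine iSup_le fun j => iSup_le fun hjN => iSup_le fun x => iSup_le fun θ => ?_
  rw [← ofReal_norm]
  refine ENNReal.ofReal_le_ofReal ((hC j x θ).trans ((le_abs_self _).trans ?_))
  exact Finset.single_le_sum (f := fun j => |C j|) (fun _ _ => abs_nonneg _)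
    (Finset.mem_range.mpr (Nat.lt_succ_of_le hjN))

/-- The space `D'(S𝕋^d)` of distributions on `S𝕋^d`: the linear forms on `C^∞(S𝕋^d)` that are
continuous, i.e. bounded by a multiple of some `C^N` norm. -/
def distributions (d : ℕ) [NeZero d] : Submodule ℂ (Module.Dual ℂ (SmoothFn d)) where
  carrier := {u | ∃ (N : ℕ) (C : ℝ≥0), ∀ ψ : SmoothFn d, ‖u ψ‖ₑ ≤ C * ckNorm N ψ.1}
  add_mem' := by
    rintro u v ⟨N, C, hu⟩ ⟨N', C', hv⟩
    refine ⟨max N N', C + C', fun ψ => ?_⟩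
    rw [LinearMap.add_apply, ENNReal.coe_add, add_mul]
    refine (enorm_add_le _ _).trans (add_le_add ((hu ψ).trans ?_) ((hv ψ).trans ?_))
    · gcongr
      exact ckNorm_mono (le_max_left _ _) _
    · gcongr
      exact ckNorm_mono (le_max_right _ _) _
  zero_mem' := ⟨0, 0, fun ψ => by simp⟩
  smul_mem' := by
    rintro c u ⟨N, C, hu⟩
    refine ⟨N, ‖c‖₊ * C, fun ψ => ?_⟩
    rw [LinearMap.smul_apply, smul_eq_mul, enorm_mul, ENNReal.coe_mul, mul_assoc]
    gcongr
    · exact le_rfl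
    · exact hu ψ

/-- `D'(S𝕋^d)` as a type. -/
abbrev Distribution (d : ℕ) [NeZero d] : Type := ↥(distributions d)

/-- A family `s ↦ L(s)` of linear operators `C^∞(S𝕋^d) → D'(S𝕋^d)` is a `C^∞` function of
`s = σ + iτ` on `Ω ⊆ ℂ` (up to the part of the boundary that belongs to `Ω`): every function
`s ↦ ⟨L(s)φ, ψ⟩` is `C^∞` on `Ω` in the real sense, and on each compact subset of `Ω` its
derivatives of each order are bounded by continuous norms of `φ` and `ψ`, so that they are
continuous operators `C^∞(S𝕋^d) → D'(S𝕋^d)`, locally uniformly in `s`. -/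
def IsSmoothFamilyOn {d : ℕ} [NeZero d] (L : ℂ → SmoothFn d →ₗ[ℂ] Distribution d)
    (Ω : Set ℂ) : Prop :=
  (∀ φ ψ : SmoothFn d, ContDiffOn ℝ ∞ (fun s => (L s φ).1 ψ) Ω) ∧
  ∀ K : Set ℂ, K ⊆ Ω → IsCompact K → ∀ k : ℕ, ∃ (N : ℕ) (C : ℝ≥0),
    ∀ s ∈ K, ∀ φ ψ : SmoothFn d,
      ‖iteratedFDerivWithin ℝ k (fun z => (L z φ).1 ψ) Ω s‖ₑ ≤ C * ckNorm N φ.1 * ckNorm N ψ.1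

/-- The spectrum of `√(-Δ)` on the compact flat torus `𝕋^d`: the numbers `lam ≥ 0` such that
`lam ^ 2` is an eigenvalue of `-Δ`, with a smooth eigenfunction. Functions on `𝕋^d` are
differentiated through their lifts to `ℝ^d`. -/
def spSqrtLaplacian (d : ℕ) : Set ℝ :=
  {lam | 0 ≤ lam ∧ ∃ f : Torus d → ℂ, f ≠ 0 ∧ ContDiff ℝ ∞ (fun x : E d => f (proj x)) ∧
    ∀ x : E d, -Laplacian.laplacian (fun y : E d => f (proj y)) x = ((lam ^ 2 : ℝ) : ℂ) * f (proj x)}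

/-- The set `i Sp(√(-Δ)) ∪ i Sp(-√(-Δ))` in `ℂ`. -/
def singularSet (d : ℕ) : Set ℂ :=
  {s | ∃ lam ∈ spSqrtLaplacian d, s = Complex.I * (lam : ℂ) ∨ s = Complex.I * (-lam : ℂ)}

end FlatTorus

end

open FlatTorus

/-! A Fourier series in `x` diagonalises the flow: on the mode of frequency `ξ = freq n`, transport
by time `t` is multiplication by `e^{-it ξ·θ}`. Integrating against `(-t)^k e^{-st}` turns this into
`(-1)^k k! (s + i ξ·θ)^{-k-1}`, so for `Re s > 0` the `k`-th derivative of `⟨L(s)φ, ψ⟩` is a sum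
over `ξ` of integrals of this kernel over `S𝕋^d` (`hasSum_modeInt`). As `Re s → 0` the kernel blows
up where `ξ·θ = -Im s`, but the integral stays bounded unless this level is one of the critical
values `±‖ξ‖` of `θ ↦ ξ·θ`, that is, unless `s² + ‖ξ‖² = 0`.

Quantitatively, put `w = s + ip` with `p = ξ·v/‖v‖`, and let `w_n = invKernel n` be the chain `w log
w - w`, `log w`, `1/w`, `-1/w²`, ... of successive derivatives. The field `‖v‖ ξ·∂_v` maps `p` to
`‖ξ‖² - p²`, and `s² + ‖ξ‖² = (‖ξ‖² - p²) + (s - ip) w`. Multiply by `w_{n+1}`: the first term is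
integrated by parts, and in the second `w w_{n+1}` is a multiple of `w_n` up to a polynomial
remainder. Each step thus trades one factor `s² + ‖ξ‖²` for one index (`oscInt_succ`), down to `w
log w - w`, which is bounded up to the boundary of the half-plane. The outcome,
`exists_bound_oscInt`, is polynomial in `‖s‖` and `‖ξ‖` and does not depend on `Re s`. Sphere
integrals are written as integrals over an annulus of `ℝ^d`, by homogeneity and a radial cutoff, so
that integration by parts takes place in flat space.

Powers of `1 - Δ_x` moved onto `φ` pay for the polynomial growth in `ξ` and make the sum over
frequencies converge. Since the numbers `‖freq n‖²` are integers, `|s² + ‖ξ‖²|` is bounded below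
uniformly in `ξ` near a compact set of regular points. Hence all derivatives of the resolvent are
bounded near regular boundary points by products of `C^N` norms (`exists_bound_resolventDeriv`).

A sequence of functions on the half-plane, each the derivative of the preceding one and all locally
bounded up to part of the boundary, extends smoothly there (`hasFDerivWithinAt_boundaryExt`);
linearity and the estimates pass to the limit. The resolvent equations for `Re s > 0` come from the
fundamental theorem of calculus in `t` and the antisymmetry of `V`. -/

noncomputable section

namespace FlatTorus

/-! ### Amplitudes on the annulus and the phase -/

section Annulus

variable {E : Type*} [NormedAddCommGroup E]

/-- The closed annulus `1 ≤ ‖v‖ ≤ 2`. -/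
def annulus (E : Type*) [NormedAddCommGroup E] : Set E := {v | 1 ≤ ‖v‖ ∧ ‖v‖ ≤ 2}

theorem isClosed_annulus : IsClosed (annulus E) :=
  (isClosed_le continuous_const continuous_norm).inter (isClosed_le continuous_norm continuous_const)

theorem ne_zero_of_mem_annulus {v : E} (hv : v ∈ annulus E) : v ≠ 0 := by
  rintro rfl
  have := hv.1
  norm_num at this

theorem annulus_subset_closedBall : annulus E ⊆ Metric.closedBall 0 2 := fun v hv => by
  simpa using hv.2

end Annulus

section Amplitude

variable {E : Type*} [NormedAddCommGroup E] [InnerProductSpace ℝ E]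

theorem isCompact_annulus [FiniteDimensional ℝ E] : IsCompact (annulus E) :=
  (isCompact_closedBall (0 : E) 2).of_isClosed_subset isClosed_annulus annulus_subset_closedBall

/-- A smooth function supported in the annulus whose derivatives of order at most `N` are bounded
by `A`. -/
structure IsAmplitude (N : ℕ) (A : ℝ) (b : E → ℂ) : Prop where
  contDiff : ContDiff ℝ ∞ b
  eq_zero : ∀ v, v ∉ annulus E → b v = 0
  bound : ∀ j ≤ N, ∀ v, ‖iteratedFDeriv ℝ j b v‖ ≤ A

namespace IsAmplitude

variable {N : ℕ} {A : ℝ} {b : E → ℂ}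

theorem nonneg (h : IsAmplitude N A b) : 0 ≤ A :=
  (norm_nonneg _).trans (h.bound 0 (Nat.zero_le _) 0)

theorem mono (h : IsAmplitude N A b) {M : ℕ} (hM : M ≤ N) : IsAmplitude M A b :=
  ⟨h.contDiff, h.eq_zero, fun j hj => h.bound j (hj.trans hM)⟩

theorem norm_le (h : IsAmplitude N A b) (v : E) : ‖b v‖ ≤ A := by
  simpa using h.bound 0 (Nat.zero_le _) v

theorem tsupport_subset (h : IsAmplitude N A b) : tsupport b ⊆ annulus E :=
  closure_minimal (fun v hv => by_contra fun hn => hv (h.eq_zero v hn)) isClosed_annulus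

theorem hasCompactSupport [FiniteDimensional ℝ E] (h : IsAmplitude N A b) : HasCompactSupport b :=
  isCompact_annulus.of_isClosed_subset (isClosed_tsupport _) h.tsupport_subset

/-- Leibniz rule, the binomial coefficients summing to at most `2 ^ N`. The factor may be singular
at the origin, because `b` vanishes near it; this admits functions homogeneous of degree 0. -/
theorem mul (h : IsAmplitude N A b) {m : E → ℂ} {B : ℝ}
    (hm : ∀ v ≠ 0, ContDiffAt ℝ ∞ m v) (hB : ∀ j ≤ N, ∀ v ∈ annulus E, ‖iteratedFDeriv ℝ j m v‖ ≤ B)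
    (hB0 : 0 ≤ B) :
    IsAmplitude N (2 ^ N * B * A) (fun v => m v * b v) := by
  have hA := h.nonneg
  have hev : ∀ v ∉ annulus E, (fun v => m v * b v) =ᶠ[nhds v] fun _ => 0 := fun v hv => by
    filter_upwards [isClosed_annulus.isOpen_compl.mem_nhds hv] with w hw
    rw [h.eq_zero w hw, mul_zero]
  refine ⟨?_, fun v hv => by simp only [h.eq_zero v hv, mul_zero], fun j hj v => ?_⟩
  · rw [contDiff_iff_contDiffAt]
    intro v
    by_cases hv : v ∈ annulus E
    · exact (hm v (ne_zero_of_mem_annulus hv)).mul h.contDiff.contDiffAt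
    · exact contDiffAt_const.congr_of_eventuallyEq (hev v hv)
  by_cases hv : v ∈ annulus E
  · have hv0 := ne_zero_of_mem_annulus hv
    have hU : IsOpen ({0}ᶜ : Set E) := isOpen_compl_singleton
    have key := norm_iteratedFDerivWithin_mul_le (𝕜 := ℝ) (N := ∞) (s := ({0}ᶜ : Set E))
      (fun w hw => (hm w hw).contDiffWithinAt) h.contDiff.contDiffOn hU.uniqueDiffOn
      (x := v) hv0 (n := j) (mod_cast le_top)
    simp only [iteratedFDerivWithin_of_isOpen _ hU (Set.mem_compl_singleton_iff.2 hv0)] at key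
    refine key.trans ?_
    calc _ ≤ ∑ i ∈ Finset.range (j + 1), (j.choose i : ℝ) * B * A := by
          refine Finset.sum_le_sum fun i hi => ?_
          have hij : i ≤ j := Nat.lt_succ_iff.1 (Finset.mem_range.1 hi)
          gcongr
          · exact hB i (hij.trans hj) v hv
          · exact h.bound _ ((Nat.sub_le _ _).trans hj) v
      _ = 2 ^ j * B * A := by
          rw [← Finset.sum_mul, ← Finset.sum_mul]
          congr 2
          exact_mod_cast Nat.sum_range_choose j
      _ ≤ 2 ^ N * B * A := by
          gcongr
          norm_num
  · rw [((hev v hv).iteratedFDeriv ℝ j).eq_of_nhds]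
    rcases j with _ | j
    · simp; positivity
    · rw [iteratedFDeriv_succ_const]; simp; positivity

theorem fderiv_apply (h : IsAmplitude (N + 1) A b) (ξ : E) :
    IsAmplitude N (‖ξ‖ * A) (fun v => fderiv ℝ b v ξ) := by
  have hc : ContDiff ℝ ∞ (fderiv ℝ b) := h.contDiff.fderiv_right (by simp)
  refine ⟨hc.clm_apply contDiff_const, fun v hv => ?_, fun j hj v => ?_⟩
  · have : b =ᶠ[nhds v] fun _ => 0 := by
      filter_upwards [isClosed_annulus.isOpen_compl.mem_nhds hv] with w hw using h.eq_zero w hw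
    rw [this.fderiv_eq]; simp
  · refine (norm_iteratedFDeriv_clm_apply_const (N := ∞) hc.contDiffAt (mod_cast le_top)).trans ?_
    rw [norm_iteratedFDeriv_fderiv]
    gcongr
    exact h.bound _ (by omega) v

end IsAmplitude

theorem exists_bound_iteratedFDeriv_annulus [FiniteDimensional ℝ E] {F : Type*}
    [NormedAddCommGroup F] [NormedSpace ℝ F] {m : E → F} (hm : ∀ v ≠ 0, ContDiffAt ℝ ∞ m v)
    (N : ℕ) : ∃ B : ℝ, 0 ≤ B ∧ ∀ j ≤ N, ∀ v ∈ annulus E, ‖iteratedFDeriv ℝ j m v‖ ≤ B := by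
  have hj : ∀ j : ℕ, ∃ C : ℝ, ∀ v ∈ annulus E, ‖iteratedFDeriv ℝ j m v‖ ≤ C := fun j =>
    isCompact_annulus.exists_bound_of_continuousOn fun v hv =>
      ((hm v (ne_zero_of_mem_annulus hv)).continuousAt_iteratedFDeriv
        (mod_cast le_top)).continuousWithinAt
  choose C hC using hj
  refine ⟨∑ j ∈ Finset.range (N + 1), |C j|, Finset.sum_nonneg fun _ _ => abs_nonneg _,
    fun j hjN v hv => (hC j v hv).trans ((le_abs_self _).trans ?_)⟩
  exact Finset.single_le_sum (f := fun j => |C j|) (fun _ _ => abs_nonneg _)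
    (Finset.mem_range.mpr (Nat.lt_succ_of_le hjN))

/-- The radial projection `v ↦ v / ‖v‖`. -/
def dir (v : E) : E := ‖v‖⁻¹ • v

theorem contDiffAt_dir {v : E} (hv : v ≠ 0) : ContDiffAt ℝ ∞ (dir : E → E) v :=
  ((contDiffAt_id.norm ℝ hv).inv (norm_ne_zero_iff.mpr hv)).smul contDiffAt_id

theorem norm_dir {v : E} (hv : v ≠ 0) : ‖dir v‖ = 1 := by
  rw [dir, norm_smul, norm_inv, norm_norm, inv_mul_cancel₀ (norm_ne_zero_iff.mpr hv)]

theorem norm_dir_le (v : E) : ‖dir v‖ ≤ 1 := by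
  rcases eq_or_ne v 0 with rfl | hv
  · simp [dir]
  · exact (norm_dir hv).le

/-- The phase `v ↦ ⟨ξ, v / ‖v‖⟩`. -/
def phase (ξ v : E) : ℝ := inner ℝ ξ (dir v)

theorem abs_phase_le (ξ v : E) : |phase ξ v| ≤ ‖ξ‖ :=
  (abs_real_inner_le_norm _ _).trans (mul_le_of_le_one_right (norm_nonneg _) (norm_dir_le v))

theorem contDiffAt_phase (ξ : E) {v : E} (hv : v ≠ 0) : ContDiffAt ℝ ∞ (phase ξ) v :=
  contDiffAt_const.inner ℝ (contDiffAt_dir hv)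

theorem contDiffAt_ofReal_phase (ξ : E) {v : E} (hv : v ≠ 0) :
    ContDiffAt ℝ ∞ (fun v => (phase ξ v : ℂ)) v :=
  Complex.ofRealCLM.contDiff.contDiffAt.comp v (contDiffAt_phase ξ hv)

/-- The phase is a linear form of norm `‖ξ‖` composed with the fixed map `dir`, so one constant
serves all frequencies. -/
theorem exists_bound_iteratedFDeriv_phase [FiniteDimensional ℝ E] (N : ℕ) :
    ∃ B : ℝ, 0 ≤ B ∧ ∀ ξ : E, ∀ j ≤ N, ∀ v ∈ annulus E,
      ‖iteratedFDeriv ℝ j (fun v => (phase ξ v : ℂ)) v‖ ≤ ‖ξ‖ * B := by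
  obtain ⟨B, hB0, hB⟩ := exists_bound_iteratedFDeriv_annulus (E := E)
    (fun v hv => contDiffAt_dir hv) N
  refine ⟨B, hB0, fun ξ j hj v hv => ?_⟩
  have h := (Complex.ofRealCLM.comp (innerSL ℝ ξ)).norm_iteratedFDeriv_comp_left (N := ∞) (n := j)
    (contDiffAt_dir (ne_zero_of_mem_annulus hv)) (mod_cast le_top)
  refine h.trans ?_
  gcongr
  · refine (ContinuousLinearMap.opNorm_comp_le _ _).trans ?_
    simp
  · exact hB j hj v hv

/-- The derivative of the phase in the direction `‖v‖ ξ`. -/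
theorem fderiv_phase_apply (ξ : E) {v : E} (hv : v ≠ 0) :
    ‖v‖ * fderiv ℝ (phase ξ) v ξ = ‖ξ‖ ^ 2 - phase ξ v ^ 2 := by
  have hn : ‖v‖ ≠ 0 := norm_ne_zero_iff.mpr hv
  -- On the line `v + tξ` the phase is the quotient of `⟨ξ, v + tξ⟩` by `‖v + tξ‖`, a one-variable
  -- computation.
  have h1 : HasDerivAt (fun t : ℝ => ‖v + t • ξ‖ ^ 2) (2 * inner ℝ v ξ) 0 := by
    have : HasDerivAt (fun t : ℝ => v + t • ξ) ξ 0 := by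
      simpa using ((hasDerivAt_id (0 : ℝ)).smul_const ξ).const_add v
    simpa using this.norm_sq
  have h2 : HasDerivAt (fun t : ℝ => ‖v + t • ξ‖) (inner ℝ v ξ / ‖v‖) 0 := by
    have := h1.sqrt (by simpa using hn)
    simp only [Real.sqrt_sq (norm_nonneg _)] at this
    convert this using 1
    simp
    field_simp
  have h3 : HasDerivAt (fun t : ℝ => phase ξ (v + t • ξ))
      ((‖ξ‖ ^ 2 * ‖v‖ - inner ℝ ξ v * (inner ℝ v ξ / ‖v‖)) / ‖v‖ ^ 2) 0 := by
    have h4 : HasDerivAt (fun t : ℝ => inner ℝ ξ (v + t • ξ)) (‖ξ‖ ^ 2) 0 := by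
      have : HasDerivAt (fun t : ℝ => inner ℝ ξ v + t * ‖ξ‖ ^ 2) (‖ξ‖ ^ 2) 0 := by
        simpa using ((hasDerivAt_id (0 : ℝ)).mul_const (‖ξ‖ ^ 2)).const_add (inner ℝ ξ v)
      convert this using 2 with t
      rw [inner_add_right, inner_smul_right, real_inner_self_eq_norm_sq]
    have h5 := h4.div h2 (by simpa using hn)
    refine (h5.congr_deriv (by simp)).congr_of_eventuallyEq (.of_forall fun t => ?_)
    simp only [phase, dir, inner_smul_right, Pi.div_apply]
    ring
  have h6 : HasDerivAt (fun t : ℝ => phase ξ (v + t • ξ)) (fderiv ℝ (phase ξ) v ξ) 0 := by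
    have hd := ((contDiffAt_phase ξ hv).differentiableAt (by simp)).hasFDerivAt
    have : HasDerivAt (fun t : ℝ => v + t • ξ) ξ 0 := by
      simpa using ((hasDerivAt_id (0 : ℝ)).smul_const ξ).const_add v
    exact HasFDerivAt.comp_hasDerivAt_of_eq (l := phase ξ) (0 : ℝ) hd this (by simp)
  rw [h6.unique h3, phase, dir, inner_smul_right, real_inner_comm v ξ]
  field_simp

end Amplitude

/-! ### Antiderivatives of `1/w` and the symbol `s + i⟨ξ, v/‖v‖⟩` -/

section Kernel

open Complex

/-- A sequence of functions on the right half-plane, each the derivative of the preceding one,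
with `w⁻¹` at index `2`. -/
def invKernel : ℕ → ℂ → ℂ
  | 0, w => w * log w - w
  | 1, w => log w
  | k + 2, w => (-1) ^ k * (k.factorial : ℂ) * (w ^ (k + 1))⁻¹

/-- The remainder in the recursion `mul_invKernel_succ`. -/
def invKernelRem : ℕ → ℂ → ℂ
  | 0, w => w
  | 1, _ => 1
  | _ + 2, _ => 0

theorem ne_zero_of_re_pos {w : ℂ} (hw : 0 < w.re) : w ≠ 0 := by
  rintro rfl; simp at hw

theorem hasDerivAt_invKernel (n : ℕ) {w : ℂ} (hw : 0 < w.re) :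
    HasDerivAt (invKernel n) (invKernel (n + 1) w) w := by
  have h0 := ne_zero_of_re_pos hw
  have hlog := Complex.hasDerivAt_log (Or.inl hw : w ∈ slitPlane)
  rcases n with _ | _ | k
  · have := ((hasDerivAt_id w).mul hlog).sub (hasDerivAt_id w)
    refine this.congr_deriv ?_
    simp [invKernel, h0]
  · refine hlog.congr_deriv ?_
    simp [invKernel]
  · have := ((hasDerivAt_pow (k + 1) w).inv (pow_ne_zero _ h0)).const_mul
      ((-1) ^ k * (k.factorial : ℂ))
    refine this.congr_deriv ?_
    simp only [invKernel, Nat.factorial_succ]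
    push_cast
    field_simp
    ring

/-- Euler's identity: `invKernel n` is homogeneous of degree `1 - n`, except for the logarithms at
indices 0 and 1, which produce the remainder. -/
theorem mul_invKernel_succ (n : ℕ) {w : ℂ} (hw : 0 < w.re) :
    w * invKernel (n + 1) w = (1 - n) * invKernel n w + invKernelRem n w := by
  have h0 := ne_zero_of_re_pos hw
  rcases n with _ | _ | k
  · simp [invKernel, invKernelRem]
  · simp [invKernel, invKernelRem, h0]
  · simp only [invKernel, invKernelRem, Nat.factorial_succ]
    push_cast
    field_simp
    ring

theorem norm_invKernelRem_le (n : ℕ) (w : ℂ) : ‖invKernelRem n w‖ ≤ 1 + ‖w‖ := by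
  rcases n with _ | _ | k <;> simp [invKernelRem, add_nonneg]

/-- This is why the chain starts two antiderivatives before `1/w`: `log w` is unbounded at 0, while
`w log w` is not, so a plain supremum bound starts the induction of `exists_bound_oscInt`. -/
theorem norm_invKernel_zero_le {w : ℂ} (hw : 0 < w.re) : ‖invKernel 0 w‖ ≤ 6 * (1 + ‖w‖) ^ 2 := by
  have hx : 0 < ‖w‖ := norm_pos_iff.mpr (ne_zero_of_re_pos hw)
  have hlog : ‖log w‖ ≤ |Real.log ‖w‖| + Real.pi := by
    refine (Complex.norm_le_abs_re_add_abs_im _).trans ?_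
    rw [Complex.log_re, Complex.log_im]
    gcongr
    exact Complex.abs_arg_le_pi w
  have hxl : ‖w‖ * |Real.log ‖w‖| ≤ 1 + ‖w‖ ^ 2 := by
    rcases le_total ‖w‖ 1 with h | h
    · have := Real.abs_log_mul_self_lt ‖w‖ hx h
      rw [abs_mul, abs_of_pos hx] at this
      nlinarith
    · rw [abs_of_nonneg (Real.log_nonneg h)]
      nlinarith [Real.log_le_self hx.le]
  have hpi := Real.pi_lt_four
  calc ‖w * log w - w‖ ≤ ‖w‖ * ‖log w‖ + ‖w‖ := by
        rw [← norm_mul]; exact norm_sub_le _ _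
    _ ≤ ‖w‖ * (|Real.log ‖w‖| + Real.pi) + ‖w‖ := by gcongr
    _ ≤ 6 * (1 + ‖w‖) ^ 2 := by nlinarith

end Kernel

section Symb

variable {E : Type*} [NormedAddCommGroup E] [InnerProductSpace ℝ E]

/-- The argument `s + i ⟨ξ, v / ‖v‖⟩`. -/
def symb (s : ℂ) (ξ v : E) : ℂ := s + Complex.I * (phase ξ v : ℂ)

theorem symb_re (s : ℂ) (ξ v : E) : (symb s ξ v).re = s.re := by simp [symb]

theorem norm_symb_le (s : ℂ) (ξ v : E) : ‖symb s ξ v‖ ≤ ‖s‖ + ‖ξ‖ := by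
  refine (norm_add_le _ _).trans ?_
  gcongr
  rw [norm_mul, Complex.norm_I, one_mul, Complex.norm_real]
  exact abs_phase_le ξ v

theorem contDiffAt_symb (s : ℂ) (ξ : E) {v : E} (hv : v ≠ 0) : ContDiffAt ℝ ∞ (symb s ξ) v :=
  contDiffAt_const.add (contDiffAt_const.mul (contDiffAt_ofReal_phase ξ hv))

theorem hasFDerivAt_invKernel_symb (n : ℕ) {s : ℂ} (hs : 0 < s.re) (ξ : E) {v : E} (hv : v ≠ 0) :
    HasFDerivAt (fun v => invKernel n (symb s ξ v))
      ((invKernel (n + 1) (symb s ξ v) * Complex.I) •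
        Complex.ofRealCLM.comp (fderiv ℝ (phase ξ) v)) v := by
  have h1 : HasFDerivAt (symb s ξ) (Complex.I • Complex.ofRealCLM.comp (fderiv ℝ (phase ξ) v)) v :=
    (((Complex.ofRealCLM.hasFDerivAt.comp v
      ((contDiffAt_phase ξ hv).differentiableAt (by simp)).hasFDerivAt).const_mul
        Complex.I).const_add s)
  have h2 := (hasDerivAt_invKernel n (w := symb s ξ v) (by rwa [symb_re])).comp_hasFDerivAt v h1
  rw [mul_smul]
  exact h2

theorem continuousAt_invKernel_symb (n : ℕ) {s : ℂ} (hs : 0 < s.re) (ξ : E) {v : E} (hv : v ≠ 0) :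
    ContinuousAt (fun v => invKernel n (symb s ξ v)) v :=
  (hasFDerivAt_invKernel_symb n hs ξ hv).continuousAt

theorem contDiffAt_ofReal_norm {v : E} (hv : v ≠ 0) :
    ContDiffAt ℝ ∞ (fun v : E => (‖v‖ : ℂ)) v :=
  Complex.ofRealCLM.contDiff.contDiffAt.comp v (contDiffAt_id.norm ℝ hv)

end Symb

/-! ### Integration by parts and bounds for oscillatory integrals -/

section Oscillatory

open MeasureTheory

variable {E : Type*} [NormedAddCommGroup E] [InnerProductSpace ℝ E] [FiniteDimensional ℝ E]
  [MeasurableSpace E] [BorelSpace E]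
set_option linter.unusedSectionVars false

theorem IsAmplitude.integrable_mul {N : ℕ} {A : ℝ} {b f : E → ℂ} (hb : IsAmplitude N A b)
    (hf : ∀ v ≠ 0, ContinuousAt f v) : Integrable (fun v => b v * f v) := by
  refine IntegrableOn.integrable_of_forall_notMem_eq_zero (s := annulus E) ?_ fun v hv => by
    rw [hb.eq_zero v hv, zero_mul]
  refine ContinuousOn.integrableOn_compact isCompact_annulus fun v hv => ?_
  exact (hb.contDiff.continuous.continuousAt.mul
    (hf v (ne_zero_of_mem_annulus hv))).continuousWithinAt

theorem IsAmplitude.norm_integral_mul_le {N : ℕ} {A M : ℝ} {b f : E → ℂ} (hb : IsAmplitude N A b)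
    (hf : ∀ v ≠ 0, ‖f v‖ ≤ M) :
    ‖∫ v, b v * f v‖ ≤ A * M * (volume : Measure E).real (annulus E) := by
  rw [← setIntegral_eq_integral_of_forall_compl_eq_zero (s := annulus E) fun v hv => by
    rw [hb.eq_zero v hv, zero_mul]]
  refine norm_setIntegral_le_of_norm_le_const isCompact_annulus.measure_lt_top fun v hv => ?_
  rw [norm_mul]
  exact mul_le_mul (hb.norm_le v) (hf v (ne_zero_of_mem_annulus hv)) (norm_nonneg _) hb.nonneg

/-- The oscillatory integral `∫ b(v) w_n(s + i ⟨ξ, v / ‖v‖⟩) dv`, where `w_n = invKernel n`. -/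
def oscInt (n : ℕ) (s : ℂ) (ξ : E) (b : E → ℂ) : ℂ := ∫ v, b v * invKernel n (symb s ξ v)

/-- The transpose of the vector field `‖v‖ ξ · ∂_v`, up to sign. -/
def radDeriv (ξ : E) (b : E → ℂ) (v : E) : ℂ := fderiv ℝ (fun v => (‖v‖ : ℂ) * b v) v ξ

theorem exists_isAmplitude_norm_mul (N : ℕ) : ∃ c : ℝ, 0 ≤ c ∧ ∀ (A : ℝ) (b : E → ℂ),
    IsAmplitude N A b → IsAmplitude N (c * A) (fun v => (‖v‖ : ℂ) * b v) := by
  obtain ⟨B, hB0, hB⟩ := exists_bound_iteratedFDeriv_annulus (E := E)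
    (fun v hv => contDiffAt_ofReal_norm hv) N
  exact ⟨2 ^ N * B, by positivity, fun A b hb => hb.mul (fun v hv => contDiffAt_ofReal_norm hv) hB hB0⟩

theorem exists_isAmplitude_radDeriv (N : ℕ) : ∃ c : ℝ, 0 ≤ c ∧ ∀ (ξ : E) (A : ℝ) (b : E → ℂ),
    IsAmplitude (N + 1) A b → IsAmplitude N (‖ξ‖ * (c * A)) (radDeriv ξ b) := by
  obtain ⟨c, hc0, hc⟩ := exists_isAmplitude_norm_mul (E := E) (N + 1)
  exact ⟨c, hc0, fun ξ A b hb => (hc A b hb).fderiv_apply ξ⟩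

theorem exists_isAmplitude_phase_mul (N : ℕ) : ∃ c : ℝ, 0 ≤ c ∧ ∀ (ξ : E) (A : ℝ) (b : E → ℂ),
    IsAmplitude N A b → IsAmplitude N (‖ξ‖ * (c * A)) (fun v => (phase ξ v : ℂ) * b v) := by
  obtain ⟨B, hB0, hB⟩ := exists_bound_iteratedFDeriv_phase (E := E) N
  refine ⟨2 ^ N * B, by positivity, fun ξ A b hb => ?_⟩
  have := hb.mul (fun v hv => contDiffAt_ofReal_phase ξ hv) (hB ξ) (by positivity)
  convert this using 1
  ring

/-- Integration by parts along the field `‖v‖ ξ · ∂_v`, which differentiates the phase to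
`‖ξ‖² - ⟨ξ, v / ‖v‖⟩²`. -/
theorem integral_radDeriv_mul (n : ℕ) {s : ℂ} (hs : 0 < s.re) (ξ : E) {N : ℕ} {A : ℝ} {b : E → ℂ}
    (hb : IsAmplitude (N + 1) A b) :
    ∫ v, b v * (((‖ξ‖ ^ 2 - phase ξ v ^ 2 : ℝ) : ℂ) * invKernel (n + 1) (symb s ξ v)) =
      Complex.I * oscInt n s ξ (radDeriv ξ b) := by
  obtain ⟨c, -, hc⟩ := exists_isAmplitude_norm_mul (E := E) (N + 1)
  have hb1 := hc A b hb
  have hb2 := hb1.fderiv_apply ξ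
  set f : E → ℂ := fun v => (‖v‖ : ℂ) * b v with hf
  set g : E → ℂ := fun v => invKernel n (symb s ξ v) with hg
  -- The weight `‖v‖` contained in `f` clears the denominator in the derivative of the phase.
  have key : ∀ v, f v * fderiv ℝ g v ξ =
      Complex.I * (b v * (((‖ξ‖ ^ 2 - phase ξ v ^ 2 : ℝ) : ℂ) * invKernel (n + 1) (symb s ξ v))) := by
    intro v
    by_cases hv : v ∈ annulus E
    · have hv0 := ne_zero_of_mem_annulus hv
      rw [hg, (hasFDerivAt_invKernel_symb n hs ξ hv0).fderiv, ← fderiv_phase_apply ξ hv0, hf]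
      simp
      ring
    · simp [hf, hb.eq_zero v hv]
  have hint : Integrable fun v => b v *
      (((‖ξ‖ ^ 2 - phase ξ v ^ 2 : ℝ) : ℂ) * invKernel (n + 1) (symb s ξ v)) := by
    refine hb.integrable_mul fun v hv => ContinuousAt.mul ?_
      (continuousAt_invKernel_symb _ hs ξ hv)
    refine Complex.continuous_ofReal.continuousAt.comp ?_
    exact continuousAt_const.sub ((contDiffAt_phase ξ hv).continuousAt.pow 2)
  have ibp := integral_mul_fderiv_eq_neg_fderiv_mul_of_integrable (μ := volume) (f := f) (g := g)
    (v := ξ) (hb2.integrable_mul fun v hv => continuousAt_invKernel_symb n hs ξ hv)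
    (by simp only [key]; exact hint.const_mul _)
    (hb1.integrable_mul fun v hv => continuousAt_invKernel_symb n hs ξ hv)
    (fun v _ => hb1.contDiff.contDiffAt.differentiableAt (by simp))
    (fun v hv => (hasFDerivAt_invKernel_symb n hs ξ
      (ne_zero_of_mem_annulus (hb1.tsupport_subset hv))).differentiableAt)
  simp only [key] at ibp
  rw [integral_const_mul] at ibp
  have h2 : ∫ v, fderiv ℝ f v ξ * g v = oscInt n s ξ (radDeriv ξ b) := rfl
  rw [h2] at ibp
  linear_combination (-Complex.I) * ibp +
    (∫ v, b v * (((‖ξ‖ ^ 2 - phase ξ v ^ 2 : ℝ) : ℂ) * invKernel (n + 1) (symb s ξ v))) *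
      Complex.I_mul_I

/-- With `w = s + ip`, one has `s² + ‖ξ‖² = (‖ξ‖² - p²) + (s - ip) w`. The first summand is handled
by `integral_radDeriv_mul`, the second by the Euler identity `mul_invKernel_succ`. -/
theorem oscInt_succ (n : ℕ) {s : ℂ} (hs : 0 < s.re) (ξ : E) {N : ℕ} {A : ℝ} {b : E → ℂ}
    (hb : IsAmplitude (N + 1) A b) :
    (s ^ 2 + ‖ξ‖ ^ 2) * oscInt (n + 1) s ξ b =
      Complex.I * oscInt n s ξ (radDeriv ξ b) +
      (1 - n) * (s * oscInt n s ξ b - Complex.I * oscInt n s ξ (fun v => (phase ξ v : ℂ) * b v)) +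
      (s * (∫ v, b v * invKernelRem n (symb s ξ v)) -
        Complex.I * ∫ v, ((phase ξ v : ℂ) * b v) * invKernelRem n (symb s ξ v)) := by
  obtain ⟨c, -, hc⟩ := exists_isAmplitude_phase_mul (E := E) (N + 1)
  have hb1 := hc ξ A b hb
  have hker := fun (v : E) (hv : v ≠ 0) => continuousAt_invKernel_symb n hs ξ hv
  have hrem : ∀ v : E, v ≠ 0 → ContinuousAt (fun v => invKernelRem n (symb s ξ v)) v := by
    intro v hv
    rcases n with _ | _ | k
    · exact (contDiffAt_symb s ξ hv).continuousAt
    · exact continuousAt_const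
    · exact continuousAt_const
  have i1 : Integrable fun v => b v *
      (((‖ξ‖ ^ 2 - phase ξ v ^ 2 : ℝ) : ℂ) * invKernel (n + 1) (symb s ξ v)) := by
    refine hb.integrable_mul fun v hv => ContinuousAt.mul ?_
      (continuousAt_invKernel_symb _ hs ξ hv)
    refine Complex.continuous_ofReal.continuousAt.comp ?_
    exact continuousAt_const.sub ((contDiffAt_phase ξ hv).continuousAt.pow 2)
  have i2 := hb.integrable_mul hker
  have i3 := hb1.integrable_mul hker
  have i4 := hb.integrable_mul hrem
  have i5 := hb1.integrable_mul hrem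
  rw [← integral_radDeriv_mul n hs ξ hb]
  have key : ∀ v, (s ^ 2 + (‖ξ‖ : ℂ) ^ 2) * (b v * invKernel (n + 1) (symb s ξ v)) =
      b v * (((‖ξ‖ ^ 2 - phase ξ v ^ 2 : ℝ) : ℂ) * invKernel (n + 1) (symb s ξ v)) +
      (1 - n) * (s * (b v * invKernel n (symb s ξ v)) -
        Complex.I * ((phase ξ v : ℂ) * b v * invKernel n (symb s ξ v))) +
      (s * (b v * invKernelRem n (symb s ξ v)) -
        Complex.I * ((phase ξ v : ℂ) * b v * invKernelRem n (symb s ξ v))) := fun v => by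
    have h := mul_invKernel_succ n (w := symb s ξ v) (by rwa [symb_re])
    have hI := Complex.I_mul_I
    simp only [symb] at h ⊢
    push_cast
    linear_combination (s - Complex.I * phase ξ v) * b v * h +
      b v * phase ξ v ^ 2 * invKernel (n + 1) (s + Complex.I * phase ξ v) * hI
  unfold oscInt
  have j1 : Integrable fun v => s * (b v * invKernel n (symb s ξ v)) -
      Complex.I * ((phase ξ v : ℂ) * b v * invKernel n (symb s ξ v)) :=
    (i2.const_mul s).sub (i3.const_mul Complex.I)
  have j2 : Integrable fun v => s * (b v * invKernelRem n (symb s ξ v)) -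
      Complex.I * ((phase ξ v : ℂ) * b v * invKernelRem n (symb s ξ v)) :=
    (i4.const_mul s).sub (i5.const_mul Complex.I)
  have j3 : Integrable fun v =>
      b v * (((‖ξ‖ ^ 2 - phase ξ v ^ 2 : ℝ) : ℂ) * invKernel (n + 1) (symb s ξ v)) +
      (1 - n) * (s * (b v * invKernel n (symb s ξ v)) -
        Complex.I * ((phase ξ v : ℂ) * b v * invKernel n (symb s ξ v))) :=
    i1.add (j1.const_mul _)
  rw [← integral_const_mul, integral_congr_ae (.of_forall key),
    integral_add j3 j2, integral_add i1 (j1.const_mul _),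
    integral_const_mul, integral_sub (i2.const_mul s) (i3.const_mul Complex.I),
    integral_sub (i4.const_mul s) (i5.const_mul Complex.I), integral_const_mul, integral_const_mul,
    integral_const_mul, integral_const_mul]

/-- Induction on the index by `oscInt_succ`; each step uses one derivative of the amplitude and one
factor `s² + ‖ξ‖²`. What matters is that `C` is independent of `s`, hence of the distance to the
imaginary axis. -/
theorem exists_bound_oscInt (n : ℕ) : ∃ C : ℝ, 0 ≤ C ∧ ∀ (s : ℂ) (ξ : E) (A : ℝ) (b : E → ℂ),
    0 < s.re → IsAmplitude n A b →
    ‖s ^ 2 + (‖ξ‖ : ℂ) ^ 2‖ ^ n * ‖oscInt n s ξ b‖ ≤ C * (1 + ‖s‖ + ‖ξ‖) ^ (2 * n + 2) * A := by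
  set κ := (volume : Measure E).real (annulus E) with hκ
  have hκ0 : 0 ≤ κ := measureReal_nonneg
  induction n with
  | zero =>
    refine ⟨6 * κ, by positivity, fun s ξ A b hs hb => ?_⟩
    have hA := hb.nonneg
    rw [pow_zero, one_mul]
    refine (hb.norm_integral_mul_le (M := 6 * (1 + ‖s‖ + ‖ξ‖) ^ 2) fun v hv => ?_).trans
      (le_of_eq (by ring))
    refine (norm_invKernel_zero_le (by rwa [symb_re])).trans ?_
    gcongr 6 * ?_ ^ 2
    linarith [norm_symb_le s ξ v]
  | succ n ih =>
    obtain ⟨C, hC0, hC⟩ := ih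
    obtain ⟨c1, hc10, hc1⟩ := exists_isAmplitude_radDeriv (E := E) n
    obtain ⟨c2, hc20, hc2⟩ := exists_isAmplitude_phase_mul (E := E) n
    refine ⟨C * c1 + (n + 1) * (C + C * c2) + κ * (1 + c2), by positivity,
      fun s ξ A b hs hb => ?_⟩
    have hA := hb.nonneg
    have hbn := hb.mono (Nat.le_succ n)
    have hb2 := hc2 ξ A b hbn
    have h1 := hC s ξ _ _ hs (hc1 ξ A b hb)
    have h2 := hC s ξ _ _ hs hbn
    have h3 := hC s ξ _ _ hs hb2
    set X := 1 + ‖s‖ + ‖ξ‖ with hX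
    have hX1 : 1 ≤ X := by rw [hX]; linarith [norm_nonneg s, norm_nonneg ξ]
    have hsX : ‖s‖ ≤ X := by rw [hX]; linarith [norm_nonneg ξ]
    have hξX : ‖ξ‖ ≤ X := by rw [hX]; linarith [norm_nonneg s]
    have hrem : ∀ v : E, v ≠ 0 → ‖invKernelRem n (symb s ξ v)‖ ≤ X := fun v _ =>
      (norm_invKernelRem_le _ _).trans (by rw [hX]; linarith [norm_symb_le s ξ v])
    have h4 := hbn.norm_integral_mul_le hrem
    have h5 := hb2.norm_integral_mul_le hrem
    set q := ‖s ^ 2 + (‖ξ‖ : ℂ) ^ 2‖ with hq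
    -- The remainder integrals are bounded without any factor `q`, so the `q ^ n` in front of them
    -- is estimated crudely by powers of `X`.
    have hqX : q ≤ X ^ 2 := by
      refine (norm_add_le _ _).trans ?_
      rw [norm_pow, norm_pow, Complex.norm_real, norm_norm, hX]
      nlinarith [norm_nonneg s, norm_nonneg ξ, mul_nonneg (norm_nonneg s) (norm_nonneg ξ)]
    have hq0 : 0 ≤ q := norm_nonneg _
    have hqn : q ^ n ≤ X ^ (2 * n) := by
      rw [pow_mul]; gcongr
    have hn : ‖(1 - n : ℂ)‖ ≤ n + 1 := by
      refine (norm_sub_le _ _).trans ?_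
      simp [add_comm]
    have hrec : q * ‖oscInt (n + 1) s ξ b‖ ≤ ‖oscInt n s ξ (radDeriv ξ b)‖ +
        (n + 1) * (‖s‖ * ‖oscInt n s ξ b‖ + ‖oscInt n s ξ (fun v => (phase ξ v : ℂ) * b v)‖) +
        (‖s‖ * ‖∫ v, b v * invKernelRem n (symb s ξ v)‖ +
          ‖∫ v, ((phase ξ v : ℂ) * b v) * invKernelRem n (symb s ξ v)‖) := by
      rw [hq, ← norm_mul, oscInt_succ n hs ξ hb]
      refine (norm_add_le _ _).trans (add_le_add ((norm_add_le _ _).trans (add_le_add ?_ ?_)) ?_)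
      · simp
      · rw [norm_mul]
        gcongr
        refine (norm_sub_le _ _).trans ?_
        simp
      · refine (norm_sub_le _ _).trans ?_
        simp
    have hJ2 := norm_nonneg (oscInt n s ξ b)
    have hJ4 := norm_nonneg (∫ v, b v * invKernelRem n (symb s ξ v))
    have hJ5 := norm_nonneg (∫ v, ((phase ξ v : ℂ) * b v) * invKernelRem n (symb s ξ v))
    generalize ‖oscInt (n + 1) s ξ b‖ = J at *
    generalize ‖oscInt n s ξ (radDeriv ξ b)‖ = J1 at *
    generalize ‖oscInt n s ξ b‖ = J2 at *
    generalize ‖oscInt n s ξ (fun v => (phase ξ v : ℂ) * b v)‖ = J3 at *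
    generalize ‖∫ v, b v * invKernelRem n (symb s ξ v)‖ = J4 at *
    generalize ‖∫ v, ((phase ξ v : ℂ) * b v) * invKernelRem n (symb s ξ v)‖ = J5 at *
    calc q ^ (n + 1) * J = q ^ n * (q * J) := by ring
      _ ≤ q ^ n * (J1 + (n + 1) * (‖s‖ * J2 + J3) + (‖s‖ * J4 + J5)) := by gcongr
      _ = q ^ n * J1 + (n + 1) * (‖s‖ * (q ^ n * J2) + q ^ n * J3) + q ^ n * (‖s‖ * J4 + J5) := by
        ring
      _ ≤ C * X ^ (2 * n + 2) * (X * (c1 * A)) +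
          (n + 1) * (X * (C * X ^ (2 * n + 2) * A) + C * X ^ (2 * n + 2) * (X * (c2 * A))) +
          X ^ (2 * n) * (X * (A * X * κ) + X * (c2 * A) * X * κ) := by
        have f1 : q ^ n * J1 ≤ C * X ^ (2 * n + 2) * (X * (c1 * A)) := h1.trans (by gcongr)
        have f3 : q ^ n * J3 ≤ C * X ^ (2 * n + 2) * (X * (c2 * A)) := h3.trans (by gcongr)
        have f2 : ‖s‖ * (q ^ n * J2) ≤ X * (C * X ^ (2 * n + 2) * A) :=
          mul_le_mul hsX h2 (mul_nonneg (pow_nonneg hq0 n) hJ2) (by positivity)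
        have f4 : ‖s‖ * J4 ≤ X * (A * X * κ) := mul_le_mul hsX h4 hJ4 (by positivity)
        have f5 : J5 ≤ X * (c2 * A) * X * κ := h5.trans (by gcongr)
        have f6 : q ^ n * (‖s‖ * J4 + J5) ≤
            X ^ (2 * n) * (X * (A * X * κ) + X * (c2 * A) * X * κ) :=
          mul_le_mul hqn (add_le_add f4 f5) (by positivity) (by positivity)
        exact add_le_add (add_le_add f1 (mul_le_mul_of_nonneg_left (add_le_add f2 f3)
          (by positivity))) f6
      _ = (C * c1 + (n + 1) * (C + C * c2)) * A * X ^ (2 * n + 3) +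
          κ * (1 + c2) * A * X ^ (2 * n + 2) := by ring
      _ ≤ (C * c1 + (n + 1) * (C + C * c2)) * A * X ^ (2 * (n + 1) + 2) +
          κ * (1 + c2) * A * X ^ (2 * (n + 1) + 2) := by
        have f7 : X ^ (2 * n + 3) ≤ X ^ (2 * (n + 1) + 2) := pow_le_pow_right₀ hX1 (by omega)
        have f8 : X ^ (2 * n + 2) ≤ X ^ (2 * (n + 1) + 2) := pow_le_pow_right₀ hX1 (by omega)
        gcongr
      _ = _ := by ring

end Oscillatory

/-! ### Smooth extension of holomorphic functions to the boundary of the half-plane -/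

section Extension

open Filter Topology

/-- The open right half-plane. -/
def rightHalfPlane : Set ℂ := {s | 0 < s.re}

theorem isOpen_rightHalfPlane : IsOpen rightHalfPlane :=
  isOpen_lt continuous_const Complex.continuous_re

theorem convex_rightHalfPlane : Convex ℝ rightHalfPlane := convex_halfSpace_re_gt 0

theorem closure_rightHalfPlane : closure rightHalfPlane = {s | 0 ≤ s.re} :=
  Complex.closure_setOfPred_lt_re 0

/-- A sequence of functions on the right half-plane, each the derivative of the preceding one. -/
def IsDerivChain (H : ℕ → ℂ → ℂ) : Prop :=
  ∀ k, ∀ s ∈ rightHalfPlane, HasDerivAt (H k) (H (k + 1) s) s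

/-- The function `h` on the right half-plane is bounded near `s₀`. -/
def BoundedNear (h : ℂ → ℂ) (s₀ : ℂ) : Prop :=
  ∃ C : ℝ≥0, ∀ᶠ s in 𝓝[rightHalfPlane] s₀, ‖h s‖₊ ≤ C

variable {H : ℕ → ℂ → ℂ} {Ω : Set ℂ}

/-- A bounded derivative on the convex set `ball ∩ rightHalfPlane` makes `h` Lipschitz there, so
Cauchy filters have limits. The limits exist on a whole ball, as the extension of the derivative
requires. -/
theorem exists_tendsto_of_boundedNear {h h' : ℂ → ℂ}
    (hh : ∀ s ∈ rightHalfPlane, HasDerivAt h (h' s) s) {s₀ : ℂ} (hb : BoundedNear h' s₀) :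
    ∃ r > 0, ∀ s ∈ Metric.ball s₀ r, 0 ≤ s.re → ∃ l, Tendsto h (𝓝[rightHalfPlane] s) (𝓝 l) := by
  obtain ⟨C, hC⟩ := hb
  obtain ⟨r, hr, hrC⟩ := Metric.mem_nhdsWithin_iff.1 hC
  refine ⟨r, hr, fun s hs hs0 => ?_⟩
  have hlip : LipschitzOnWith C h (Metric.ball s₀ r ∩ rightHalfPlane) :=
    ((convex_ball s₀ r).inter convex_rightHalfPlane).lipschitzOnWith_of_nnnorm_hasDerivWithin_le
      (fun z hz => (hh z hz.2).hasDerivWithinAt) fun z hz => hrC hz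
  have hne : (𝓝[rightHalfPlane] s).NeBot :=
    mem_closure_iff_nhdsWithin_neBot.1 (by rw [closure_rightHalfPlane]; exact hs0)
  have heq : 𝓝[Metric.ball s₀ r ∩ rightHalfPlane] s = 𝓝[rightHalfPlane] s :=
    nhdsWithin_inter_of_mem (mem_nhdsWithin_of_mem_nhds (Metric.isOpen_ball.mem_nhds hs))
  have hcau : Cauchy (𝓝[rightHalfPlane] s) := cauchy_nhds.mono nhdsWithin_le_nhds
  have hmap := hcau.map_of_le hlip.uniformContinuousOn (by rw [← heq]; exact inf_le_right)
  exact CompleteSpace.complete hmap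

/-- The boundary values of `H k`, together with the values of `H k` in the open half-plane. -/
def boundaryExt (H : ℕ → ℂ → ℂ) (k : ℕ) : ℂ → ℂ := extendFrom rightHalfPlane (H k)

theorem boundaryExt_of_mem (hH : IsDerivChain H) (k : ℕ) {s : ℂ} (hs : s ∈ rightHalfPlane) :
    boundaryExt H k s = H k s :=
  extendFrom_eq (subset_closure hs) (hH k s hs).continuousAt.continuousWithinAt

theorem tendsto_boundaryExt (hH : IsDerivChain H) (k : ℕ) {s : ℂ}
    (hs0 : 0 ≤ s.re) (hb : BoundedNear (H (k + 1)) s) :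
    Tendsto (H k) (𝓝[rightHalfPlane] s) (𝓝 (boundaryExt H k s)) := by
  obtain ⟨r, hr, h⟩ := exists_tendsto_of_boundedNear (hH k) hb
  exact tendsto_extendFrom (h s (Metric.mem_ball_self hr) hs0)

theorem norm_boundaryExt_le (hH : IsDerivChain H) (k : ℕ) {s : ℂ}
    (hs0 : 0 ≤ s.re) (hb : BoundedNear (H (k + 1)) s) {C : ℝ}
    (hC : ∀ᶠ z in 𝓝[rightHalfPlane] s, ‖H k z‖ ≤ C) : ‖boundaryExt H k s‖ ≤ C := by
  have hne : (𝓝[rightHalfPlane] s).NeBot :=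
    mem_closure_iff_nhdsWithin_neBot.1 (by rw [closure_rightHalfPlane]; exact hs0)
  exact le_of_tendsto (tendsto_boundaryExt hH k hs0 hb).norm hC

/-- A function on a convex open set that, together with its derivative, has limits at the boundary
is differentiable there, with the limit as derivative. Boundedness of `H (k + 1)` gives the limits
of `H k`, that of `H (k + 2)` gives the limit of the derivative. -/
theorem hasFDerivWithinAt_boundaryExt (hH : IsDerivChain H) (hΩ : Ω ⊆ {s | 0 ≤ s.re})
    (hb : ∀ s ∈ Ω, ∀ k, BoundedNear (H k) s) (k : ℕ) {s₀ : ℂ} (hs₀ : s₀ ∈ Ω) :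
    HasFDerivWithinAt (𝕜 := ℝ) (boundaryExt H k)
      ((ContinuousLinearMap.toSpanSingleton ℂ (boundaryExt H (k + 1) s₀)).restrictScalars ℝ)
      Ω s₀ := by
  obtain ⟨r, hr, hlim⟩ := exists_tendsto_of_boundedNear (hH k) (hb s₀ hs₀ (k + 1))
  -- Half the radius keeps the closure of `S` inside the ball where boundary limits are known to
  -- exist.
  set S : Set ℂ := Metric.ball s₀ (r / 2) ∩ rightHalfPlane with hS
  have hSP : S ⊆ rightHalfPlane := Set.inter_subset_right
  have hder : ∀ s ∈ rightHalfPlane, HasFDerivAt (𝕜 := ℝ) (boundaryExt H k)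
      ((ContinuousLinearMap.toSpanSingleton ℂ (H (k + 1) s)).restrictScalars ℝ) s := by
    intro s hs
    refine ((hH k s hs).hasFDerivAt.restrictScalars ℝ).congr_of_eventuallyEq ?_
    filter_upwards [isOpen_rightHalfPlane.mem_nhds hs] with z hz using boundaryExt_of_mem hH k hz
  have hclos : closure S ⊆ Metric.ball s₀ r ∩ {s | 0 ≤ s.re} := by
    refine (closure_inter_subset_inter_closure _ _).trans (Set.inter_subset_inter ?_ ?_)
    · exact Metric.closure_ball_subset_closedBall.trans
        (Metric.closedBall_subset_ball (half_lt_self hr))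
    · rw [closure_rightHalfPlane]
  have key := hasFDerivWithinAt_closure_of_tendsto_fderiv (f := boundaryExt H k) (s := S)
    (x := s₀)
    (f' := (ContinuousLinearMap.toSpanSingleton ℂ (boundaryExt H (k + 1) s₀)).restrictScalars ℝ)
    (fun s hs => (hder s (hSP hs)).differentiableAt.differentiableWithinAt)
    ((convex_ball _ _).inter convex_rightHalfPlane)
    (Metric.isOpen_ball.inter isOpen_rightHalfPlane)
    (fun y hy => ?_) ?_
  · refine key.mono_of_mem_nhdsWithin ?_
    have : Metric.ball s₀ (r / 2) ∩ {s | 0 ≤ s.re} ⊆ closure S := by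
      rw [← closure_rightHalfPlane]
      exact Metric.isOpen_ball.inter_closure
    refine Filter.mem_of_superset ?_ this
    exact Filter.inter_mem
      (mem_nhdsWithin_of_mem_nhds (Metric.ball_mem_nhds s₀ (half_pos hr)))
      (Filter.mem_of_superset self_mem_nhdsWithin hΩ)
  · have hy' := hclos hy
    have h1 : Tendsto (H k) (𝓝[rightHalfPlane] y) (𝓝 (boundaryExt H k y)) :=
      tendsto_extendFrom (hlim y hy'.1 hy'.2)
    refine (h1.mono_left (nhdsWithin_mono y hSP)).congr' ?_
    filter_upwards [self_mem_nhdsWithin] with z hz using (boundaryExt_of_mem hH k (hSP hz)).symm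
  · have h1 := (tendsto_boundaryExt hH (k + 1) (hΩ hs₀) (hb s₀ hs₀ (k + 2))).mono_left
      (nhdsWithin_mono s₀ hSP)
    have hc : Continuous fun z : ℂ =>
        (ContinuousLinearMap.toSpanSingleton ℂ z).restrictScalars ℝ := by
      refine (ContinuousLinearMap.continuous_restrictScalars ℝ).comp ?_
      exact (ContinuousLinearMap.toSpanSingletonCLE (𝕜 := ℂ) (E := ℂ)).continuous
    refine ((hc.tendsto _).comp h1).congr' ?_
    filter_upwards [self_mem_nhdsWithin] with z hz using ((hder z (hSP hz)).fderiv).symm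

/-- The `k`-th real derivative of a holomorphic function is `(h₁, …, h_k) ↦ H_k(s) h₁ ⋯ h_k`, and
this form persists at the boundary. -/
theorem hasFTaylorSeriesUpToOn_boundaryExt (hH : IsDerivChain H) (hΩ : Ω ⊆ {s | 0 ≤ s.re})
    (hb : ∀ s ∈ Ω, ∀ k, BoundedNear (H k) s) :
    HasFTaylorSeriesUpToOn (𝕜 := ℝ) ∞ (boundaryExt H 0)
      (fun s k => boundaryExt H k s • ContinuousMultilinearMap.mkPiAlgebraFin ℝ k ℂ) Ω := by
  have hd := fun k s hs => hasFDerivWithinAt_boundaryExt hH hΩ hb k (s₀ := s) hs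
  refine ⟨fun s _ => by simp [ContinuousMultilinearMap.curry0], fun k _ s hs => ?_, fun k _ s hs => ?_⟩
  · refine ((hd k s hs).smul_const
      (ContinuousMultilinearMap.mkPiAlgebraFin ℝ k ℂ)).congr_fderiv ?_
    ext h m
    simp [List.prod_ofFn, mul_assoc, mul_comm, mul_left_comm]
  · exact (hd k s hs).continuousWithinAt.smul continuousWithinAt_const

theorem contDiffOn_boundaryExt (hH : IsDerivChain H) (hΩ : Ω ⊆ {s | 0 ≤ s.re})
    (hb : ∀ s ∈ Ω, ∀ k, BoundedNear (H k) s) : ContDiffOn ℝ ∞ (boundaryExt H 0) Ω :=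
  fun s hs => (hasFTaylorSeriesUpToOn_boundaryExt hH hΩ hb).contDiffOn s hs

theorem norm_iteratedFDerivWithin_boundaryExt_le (hH : IsDerivChain H) (hΩ : Ω ⊆ {s | 0 ≤ s.re})
    (hP : rightHalfPlane ⊆ Ω) (hb : ∀ s ∈ Ω, ∀ k, BoundedNear (H k) s) (k : ℕ) {s : ℂ}
    (hs : s ∈ Ω) :
    ‖iteratedFDerivWithin ℝ k (boundaryExt H 0) Ω s‖ ≤ ‖boundaryExt H k s‖ := by
  -- `Ω` lies between the open half-plane, which is convex, and its closure, so derivatives within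
  -- `Ω` are unique.
  have hu : UniqueDiffOn ℝ Ω := fun z hz => by
    refine UniqueDiffWithinAt.mono (uniqueDiffWithinAt_convex convex_rightHalfPlane ?_ ?_) hP
    · rw [isOpen_rightHalfPlane.interior_eq]
      exact ⟨1, by simp [rightHalfPlane]⟩
    · rw [closure_rightHalfPlane]
      exact hΩ hz
  rw [← (hasFTaylorSeriesUpToOn_boundaryExt hH hΩ hb).eq_iteratedFDerivWithin_of_uniqueDiffOn
    (mod_cast le_top) hu hs, norm_smul]
  refine mul_le_of_le_one_right (norm_nonneg _) ?_
  simp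

end Extension

/-! ### Sphere integrals as integrals over the annulus -/

section Cutoff

open MeasureTheory

/-- A bump function on `ℝ` supported in `(1, 4)`. -/
def radialBump : ContDiffBump (5 / 2 : ℝ) := ⟨1, 3 / 2, one_pos, by norm_num⟩

/-- A radial cutoff function supported in the annulus. -/
def cutoff {E : Type*} [NormedAddCommGroup E] (v : E) : ℂ := (radialBump (‖v‖ ^ 2) : ℝ)

theorem cutoff_eq_zero {E : Type*} [NormedAddCommGroup E] {v : E} (hv : v ∉ annulus E) : cutoff v = 0 := by
  rw [cutoff, radialBump.zero_of_le_dist, Complex.ofReal_zero]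
  change 3 / 2 ≤ dist (‖v‖ ^ 2) (5 / 2)
  rw [Real.dist_eq]
  by_contra h
  push Not at h
  rw [abs_lt] at h
  refine hv ⟨?_, ?_⟩ <;> nlinarith [norm_nonneg v]

variable {E : Type*} [NormedAddCommGroup E] [InnerProductSpace ℝ E]

theorem contDiff_cutoff : ContDiff ℝ ∞ (cutoff : E → ℂ) :=
  Complex.ofRealCLM.contDiff.comp (radialBump.contDiff.comp (contDiff_norm_sq ℝ))

variable [FiniteDimensional ℝ E]

theorem exists_isAmplitude_cutoff (N : ℕ) : ∃ A : ℝ, IsAmplitude N A (cutoff : E → ℂ) := by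
  obtain ⟨B, hB0, hB⟩ := exists_bound_iteratedFDeriv_annulus (E := E)
    (fun v _ => contDiff_cutoff.contDiffAt) N
  refine ⟨B, contDiff_cutoff, fun v hv => cutoff_eq_zero hv, fun j hj v => ?_⟩
  by_cases hv : v ∈ annulus E
  · exact hB j hj v hv
  · have : (cutoff : E → ℂ) =ᶠ[nhds v] fun _ => 0 := by
      filter_upwards [isClosed_annulus.isOpen_compl.mem_nhds hv] with w hw using cutoff_eq_zero hw
    rw [(this.iteratedFDeriv ℝ j).eq_of_nhds]
    rcases j with _ | j
    · simpa using hB0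
    · rw [iteratedFDeriv_succ_const]; simpa using hB0

variable [MeasurableSpace E] [BorelSpace E]

/-- Polar coordinates: `f` depends only on the direction and the cutoff only on the radius, so the
integral factors. -/
theorem integral_cutoff_mul (f : E → ℂ) (hf : ∀ v ≠ 0, f (dir v) = f v) :
    ∫ v, cutoff v * f v =
      (∫ r, (radialBump ((r : ℝ) ^ 2) : ℂ) ∂(Measure.volumeIoiPow (Module.finrank ℝ E - 1))) *
        ∫ θ : Metric.sphere (0 : E) 1, f θ ∂((volume : Measure E).toSphere) := by
  have h1 : ∫ v, cutoff v * f v = ∫ v in ({0}ᶜ : Set E), cutoff v * f v := by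
    rw [setIntegral_eq_integral_of_forall_compl_eq_zero]
    intro v hv
    have : v = 0 := by simpa using hv
    subst this
    rw [cutoff_eq_zero (fun h => ne_zero_of_mem_annulus h rfl), zero_mul]
  rw [h1, ← integral_subtype_comap (measurableSet_singleton (0 : E)).compl, mul_comm,
    ← integral_prod_mul (fun θ : Metric.sphere (0 : E) 1 => f θ)
      (fun r : Set.Ioi (0 : ℝ) => (radialBump ((r : ℝ) ^ 2) : ℂ)),
    ← (volume : Measure E).measurePreserving_homeomorphUnitSphereProd.integral_comp
      (Homeomorph.measurableEmbedding _)]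
  refine integral_congr_ae (.of_forall fun v => ?_)
  have hv : (v : E) ≠ 0 := v.2
  have := hf v hv
  simp only [dir] at this
  simp only [cutoff, homeomorphUnitSphereProd_apply_fst_coe, homeomorphUnitSphereProd_apply_snd_coe,
    this]
  ring

theorem exists_integral_sphere_eq [Nontrivial E] : ∃ κ : ℂ, ∀ f : E → ℂ, (∀ v ≠ 0, f (dir v) = f v) →
    ∫ θ : Metric.sphere (0 : E) 1, f θ ∂((volume : Measure E).toSphere) =
      κ * ∫ v, cutoff v * f v := by
  set c := ∫ r, (radialBump ((r : ℝ) ^ 2) : ℂ) ∂(Measure.volumeIoiPow (Module.finrank ℝ E - 1))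
    with hc
  -- Test with `f = 1`: the cutoff is nonnegative and equals 1 where `‖v‖² = 5/2`, so its integral
  -- is positive.
  have hc0 : c ≠ 0 := by
    intro h0
    have h1 := integral_cutoff_mul (E := E) (fun _ => 1) (fun _ _ => rfl)
    rw [← hc, h0, zero_mul] at h1
    simp only [mul_one, cutoff] at h1
    rw [integral_complex_ofReal] at h1
    obtain ⟨A, hA⟩ := exists_isAmplitude_cutoff (E := E) 0
    have hcont : Continuous fun v : E => radialBump (‖v‖ ^ 2) :=
      radialBump.continuous.comp (continuous_norm.pow 2)
    have hcs : HasCompactSupport fun v : E => radialBump (‖v‖ ^ 2) := by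
      refine hA.hasCompactSupport.mono fun v hv => ?_
      simp only [Function.mem_support, cutoff] at hv ⊢
      exact_mod_cast hv
    obtain ⟨v, hv⟩ := exists_norm_eq E (c := Real.sqrt (5 / 2)) (by positivity)
    refine (hcont.integral_pos_of_hasCompactSupport_nonneg_nonzero (μ := volume) (x := v) hcs
      (fun _ => radialBump.nonneg) ?_).ne' (by exact_mod_cast h1)
    rw [hv, Real.sq_sqrt (by norm_num), radialBump.one_of_mem_closedBall]
    · exact one_ne_zero
    · exact Metric.mem_closedBall_self radialBump.rIn_pos.le
  refine ⟨c⁻¹, fun f hf => ?_⟩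
  rw [integral_cutoff_mul f hf, inv_mul_cancel_left₀ hc0]

end Cutoff

/-! ### The flow, the pairing and the transport operators -/

section Torus

open MeasureTheory Filter Topology

variable {d : ℕ}

theorem isOpenQuotientMap_proj : IsOpenQuotientMap (proj : E d → Torus d) := by
  have h1 : IsOpenQuotientMap (Pi.map fun _ : Fin d => ((↑) : ℝ → AddCircle (2 * Real.pi))) :=
    IsOpenQuotientMap.piMap fun _ => QuotientAddGroup.isOpenQuotientMap_mk
  exact h1.comp (EuclideanSpace.equiv (Fin d) ℝ).toHomeomorph.isOpenQuotientMap

theorem continuous_proj : Continuous (proj : E d → Torus d) := isOpenQuotientMap_proj.continuous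

theorem surjective_proj : Function.Surjective (proj : E d → Torus d) :=
  isOpenQuotientMap_proj.surjective

theorem proj_zero : (proj (0 : E d)) = 0 := by
  funext j; simp [proj]

theorem continuous_flow : Continuous fun q : ℝ × UnitBundle d => flow q.1 q.2 := by
  have h : Continuous fun q : ℝ × UnitBundle d => (proj (q.1 • (q.2.2 : E d)) : Torus d) :=
    continuous_proj.comp (by fun_prop)
  exact ((continuous_fst.comp continuous_snd).add h).prodMk (continuous_snd.comp continuous_snd)

theorem flow_add (t u : ℝ) (p : UnitBundle d) : flow (t + u) p = flow t (flow u p) := by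
  simp only [flow, add_smul, proj_add, add_assoc, add_comm (proj (t • (p.2 : E d)))]

theorem flow_zero (p : UnitBundle d) : flow 0 p = p := by
  simp [flow, proj_zero]

instance : IsFiniteMeasure (liouville d) := by
  unfold liouville; infer_instance

theorem integrable_liouville {f : UnitBundle d → ℂ} (hf : Continuous f) :
    Integrable f (liouville d) :=
  hf.integrable_of_hasCompactSupport (HasCompactSupport.of_compactSpace f)

/-- For fixed `θ` the flow is a translation of the torus, which preserves Haar measure. -/
theorem integral_flow {f : UnitBundle d → ℂ} (hf : Continuous f) (t : ℝ) :
    ∫ p, f (flow t p) ∂(liouville d) = ∫ p, f p ∂(liouville d) := by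
  have hft : Continuous fun p => f (flow t p) :=
    hf.comp (continuous_flow.comp (Continuous.prodMk_right t))
  have h1 := integrable_liouville hf
  have h2 := integrable_liouville hft
  unfold liouville at *
  rw [integral_prod_symm _ h1, integral_prod_symm _ h2]
  refine integral_congr_ae (.of_forall fun θ => ?_)
  exact integral_add_right_eq_self (fun x : Torus d => f (x, θ)) (proj (t • (θ : E d)))

variable [NeZero d]

theorem SmoothFn.continuous (φ : SmoothFn d) : Continuous φ.1 := by
  have hq : IsOpenQuotientMap (Prod.map (proj : E d → Torus d) (id : Sph d → Sph d)) :=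
    isOpenQuotientMap_proj.prodMap .id
  rw [hq.isQuotientMap.continuous_iff]
  exact ContMDiff.continuous φ.2

theorem SmoothFn.exists_bound (φ : SmoothFn d) : ∃ B : ℝ, 0 ≤ B ∧ ∀ p, ‖φ.1 p‖ ≤ B := by
  obtain ⟨B, hB⟩ := isCompact_univ.exists_bound_of_continuousOn φ.continuous.continuousOn
  exact ⟨|B|, abs_nonneg _, fun p => (hB p (Set.mem_univ p)).trans (le_abs_self _)⟩

theorem hasDerivAt_flow (φ : SmoothFn d) (p : UnitBundle d) (t : ℝ) :
    HasDerivAt (fun t => φ.1 (flow t p)) ((geodesicV φ).1 (flow t p)) t := by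
  have h0 : ∀ q : UnitBundle d, HasDerivAt (fun t => φ.1 (flow t q)) ((geodesicV φ).1 q) 0 := by
    intro q
    obtain ⟨x, hx⟩ := surjective_proj q.1
    have h := (contMDiff_lift_flow φ.2).comp
      ((contMDiff_const (c := ((x, q.2) : E d × Sph d))).prodMk contMDiff_id :
        ContMDiff 𝓘(ℝ, ℝ) ((𝓘(ℝ, E d).prod (𝓡 (d - 1))).prod 𝓘(ℝ, ℝ)) ∞
          fun t : ℝ => ((x, q.2), t))
    have h' : ContDiff ℝ ∞ fun t => φ.1 (flow t q) := by
      convert h.contDiff using 2 with t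
      simp [hx]
    exact (h'.differentiable (by simp) 0).hasDerivAt
  have h1 := h0 (flow t p)
  rw [← sub_self t] at h1
  have h2 := HasDerivAt.comp_sub_const t t h1
  refine h2.congr_of_eventuallyEq (.of_forall fun u => ?_)
  simp only [← flow_add, sub_add_cancel]

theorem integrable_mul_smoothFn (φ ψ : SmoothFn d) :
    Integrable (fun p => φ.1 p * ψ.1 p) (liouville d) :=
  integrable_liouville (φ.continuous.mul ψ.continuous)

theorem pairing_add_left (φ₁ φ₂ ψ : SmoothFn d) :
    pairing (φ₁ + φ₂).1 ψ.1 = pairing φ₁.1 ψ.1 + pairing φ₂.1 ψ.1 := by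
  unfold pairing
  rw [← integral_add (integrable_mul_smoothFn φ₁ ψ) (integrable_mul_smoothFn φ₂ ψ)]
  simp [add_mul]

theorem pairing_add_right (φ ψ₁ ψ₂ : SmoothFn d) :
    pairing φ.1 (ψ₁ + ψ₂).1 = pairing φ.1 ψ₁.1 + pairing φ.1 ψ₂.1 := by
  unfold pairing
  rw [← integral_add (integrable_mul_smoothFn φ ψ₁) (integrable_mul_smoothFn φ ψ₂)]
  simp [mul_add]

theorem pairing_smul_left (c : ℂ) (φ ψ : SmoothFn d) :
    pairing (c • φ).1 ψ.1 = c * pairing φ.1 ψ.1 := by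
  unfold pairing
  rw [← integral_const_mul]
  simp [mul_assoc]

theorem pairing_smul_right (c : ℂ) (φ ψ : SmoothFn d) :
    pairing φ.1 (c • ψ).1 = c * pairing φ.1 ψ.1 := by
  unfold pairing
  rw [← integral_const_mul]
  simp [mul_left_comm]

theorem transport_add (t : ℝ) (φ₁ φ₂ : SmoothFn d) :
    transport t (φ₁ + φ₂) = transport t φ₁ + transport t φ₂ := rfl

theorem transport_smul (t : ℝ) (c : ℂ) (φ : SmoothFn d) :
    transport t (c • φ) = c • transport t φ := rfl

theorem transport_zero (φ : SmoothFn d) : transport 0 φ = φ := by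
  ext p
  simp [transport, flow_zero]

theorem exists_bound_pairing_transport (φ ψ : SmoothFn d) :
    ∃ B : ℝ, ∀ t, ‖pairing (transport t φ).1 ψ.1‖ ≤ B := by
  obtain ⟨A, hA0, hA⟩ := φ.exists_bound
  obtain ⟨B, hB0, hB⟩ := ψ.exists_bound
  refine ⟨A * B * (liouville d).real Set.univ, fun t => norm_integral_le_of_norm_le_const
    (.of_forall fun p => ?_)⟩
  rw [norm_mul]
  exact mul_le_mul (hA _) (hB _) (norm_nonneg _) hA0

theorem pairing_transport_left (t : ℝ) (φ ψ : SmoothFn d) :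
    pairing (transport t φ).1 ψ.1 = pairing φ.1 (transport (-t) ψ).1 := by
  have h := integral_flow (f := fun p => φ.1 (flow (-t) p) * ψ.1 p)
    ((φ.continuous.comp (continuous_flow.comp (Continuous.prodMk_right (-t)))).mul ψ.continuous) t
  simp only [← flow_add, neg_add_cancel, flow_zero] at h
  unfold pairing transport
  simp only [neg_neg]
  exact h.symm

theorem hasDerivAt_pairing_transport (φ ψ : SmoothFn d) (t : ℝ) :
    HasDerivAt (fun t => pairing (transport t φ).1 ψ.1)
      (-pairing (transport t (geodesicV φ)).1 ψ.1) t := by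
  obtain ⟨A, hA0, hA⟩ := (geodesicV φ).exists_bound
  obtain ⟨B, hB0, hB⟩ := ψ.exists_bound
  have key := (hasDerivAt_integral_of_dominated_loc_of_deriv_le (μ := liouville d) (𝕜 := ℝ)
    (F := fun t p => (transport t φ).1 p * ψ.1 p)
    (F' := fun t p => -((transport t (geodesicV φ)).1 p * ψ.1 p)) (x₀ := t) (s := Set.univ)
    (bound := fun _ => A * B) univ_mem
    (.of_forall fun u => ((transport u φ).continuous.mul ψ.continuous).aestronglyMeasurable)
    (integrable_liouville ((transport t φ).continuous.mul ψ.continuous))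
    ((transport t (geodesicV φ)).continuous.mul ψ.continuous).neg.aestronglyMeasurable
    (.of_forall fun p u _ => ?_) (integrable_const _) (.of_forall fun p u _ => ?_)).2
  · rw [integral_neg] at key
    exact key
  · rw [norm_neg, norm_mul]
    exact mul_le_mul (hA _) (hB _) (norm_nonneg _) hA0
  · have h := (hasDerivAt_flow φ p (-u)).scomp u (hasDerivAt_neg u)
    have h2 := h.mul_const (ψ.1 p)
    refine h2.congr_deriv ?_
    simp [transport]

/-- Antisymmetry of `V`, obtained by differentiating in `t` the two expressions of `⟨e^{-tV*}φ, ψ⟩`,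
with the flow on `φ` or, reversed, on `ψ`. -/
theorem pairing_transport_geodesicV (φ ψ : SmoothFn d) (t : ℝ) :
    pairing (transport t φ).1 (geodesicV ψ).1 = -pairing (transport t (geodesicV φ)).1 ψ.1 := by
  have hsymm : ∀ φ ψ : SmoothFn d, pairing φ.1 ψ.1 = pairing ψ.1 φ.1 := fun φ ψ => by
    unfold pairing; simp only [mul_comm]
  have h1 := hasDerivAt_pairing_transport φ ψ t
  have h2 := (hasDerivAt_pairing_transport ψ φ (-t)).scomp t (hasDerivAt_neg t)
  have h3 : (fun t => pairing (transport t φ).1 ψ.1) =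
      (fun t => pairing (transport t ψ).1 φ.1) ∘ fun t => -t := by
    funext u
    simp only [Function.comp_apply]
    rw [pairing_transport_left, hsymm]
  rw [h3] at h1
  rw [h1.unique h2, pairing_transport_left, hsymm]
  simp

theorem continuous_pairing_transport (φ ψ : SmoothFn d) :
    Continuous fun t => pairing (transport t φ).1 ψ.1 :=
  continuous_iff_continuousAt.2 fun t => (hasDerivAt_pairing_transport φ ψ t).continuousAt

end Torus

/-! ### Norms of ray-constant extensions and derivatives in `x` -/

section CkNorm

open MeasureTheory Filter Topology

variable {d : ℕ}

theorem rayExt_of_ne {f : UnitBundle d → ℂ} (x : E d) {v : E d} (hv : v ≠ 0) :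
    rayExt f (x, v) = f (proj x, ⟨dir v, by simpa using norm_dir hv⟩) := by
  rw [rayExt, dif_neg hv]
  rfl

theorem rayExt_sphere (f : UnitBundle d → ℂ) (x : E d) (θ : Sph d) :
    rayExt f (x, (θ : E d)) = f (proj x, θ) := by
  have hn : ‖(θ : E d)‖ = 1 := by simp
  have hθ : (θ : E d) ≠ 0 := fun h => by simp [h] at hn
  rw [rayExt_of_ne x hθ]
  congr 2
  ext1
  simp [dir, hn]

theorem rayExt_smul (f : UnitBundle d → ℂ) {c : ℝ} (hc : 0 < c) (x v : E d) :
    rayExt f (x, c • v) = rayExt f (x, v) := by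
  rcases eq_or_ne v 0 with rfl | hv
  · simp
  · rw [rayExt_of_ne x hv, rayExt_of_ne x (smul_ne_zero hc.ne' hv)]
    congr 2
    ext1
    simp only [dir, norm_smul, Real.norm_eq_abs, abs_of_pos hc, smul_smul]
    congr 1
    field_simp

theorem sphere_ne_zero (θ : Sph d) : (θ : E d) ≠ 0 := fun h => by
  have hn : ‖(θ : E d)‖ = 1 := by simp
  simp [h] at hn

variable [NeZero d]

/-- The `C^N` norm of a smooth function, as a real number. -/
def cnorm (N : ℕ) (φ : SmoothFn d) : ℝ := (ckNorm N φ.1).toReal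

theorem cnorm_nonneg (N : ℕ) (φ : SmoothFn d) : 0 ≤ cnorm N φ := ENNReal.toReal_nonneg

theorem ofReal_cnorm (N : ℕ) (φ : SmoothFn d) : ENNReal.ofReal (cnorm N φ) = ckNorm N φ.1 :=
  ENNReal.ofReal_toReal (ckNorm_lt_top N φ).ne

theorem cnorm_mono {M N : ℕ} (h : M ≤ N) (φ : SmoothFn d) : cnorm M φ ≤ cnorm N φ :=
  ENNReal.toReal_mono (ckNorm_lt_top N φ).ne (ckNorm_mono h φ.1)

theorem norm_iteratedFDeriv_rayExt_sphere_le {j N : ℕ} (hj : j ≤ N) (φ : SmoothFn d) (x : E d)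
    (θ : Sph d) : ‖iteratedFDeriv ℝ j (rayExt φ.1) (x, (θ : E d))‖ ≤ cnorm N φ := by
  rw [← toReal_enorm]
  refine ENNReal.toReal_mono (ckNorm_lt_top N φ).ne ?_
  exact le_iSup_of_le j (le_iSup_of_le hj (le_iSup_of_le x (le_iSup_of_le θ le_rfl)))

theorem cnorm_le {N : ℕ} {φ : SmoothFn d} {C : ℝ} (hC : 0 ≤ C)
    (h : ∀ j ≤ N, ∀ (x : E d) (θ : Sph d), ‖iteratedFDeriv ℝ j (rayExt φ.1) (x, (θ : E d))‖ ≤ C) :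
    cnorm N φ ≤ C := by
  refine ENNReal.toReal_le_of_le_ofReal hC ?_
  refine iSup_le fun j => iSup_le fun hjN => iSup_le fun x => iSup_le fun θ => ?_
  rw [← ofReal_norm]
  exact ENNReal.ofReal_le_ofReal (h j hjN x θ)

theorem norm_le_cnorm (N : ℕ) (φ : SmoothFn d) (p : UnitBundle d) : ‖φ.1 p‖ ≤ cnorm N φ := by
  obtain ⟨x, hx⟩ := surjective_proj p.1
  have h := norm_iteratedFDeriv_rayExt_sphere_le (Nat.zero_le N) φ x p.2
  rw [norm_iteratedFDeriv_zero, rayExt_sphere, hx] at h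
  exact h

/-- The extension is invariant under `v ↦ v/‖v‖` for this fixed factor, a linear map of norm at most
1 when `‖v‖ ≥ 1`; so derivatives are controlled by those on the sphere. This is why the annulus lies
outside the unit ball. -/
theorem norm_iteratedFDeriv_rayExt_le {j N : ℕ} (hj : j ≤ N) (φ : SmoothFn d) (x : E d) {v : E d}
    (hv : 1 ≤ ‖v‖) : ‖iteratedFDeriv ℝ j (rayExt φ.1) (x, v)‖ ≤ cnorm N φ := by
  have hv0 : 0 < ‖v‖ := one_pos.trans_le hv
  have hvne : v ≠ 0 := norm_pos_iff.1 hv0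
  let g : (E d × E d) ≃L[ℝ] (E d × E d) :=
    (ContinuousLinearEquiv.refl ℝ (E d)).prodCongr
      (ContinuousLinearEquiv.smulLeft (Units.mk0 (‖v‖⁻¹) (inv_ne_zero hv0.ne')))
  have hg : ∀ q, g q = (q.1, ‖v‖⁻¹ • q.2) := fun q => rfl
  have hcomp : rayExt φ.1 ∘ g = rayExt φ.1 := by
    funext q
    rw [Function.comp_apply, hg, rayExt_smul _ (inv_pos.2 hv0)]
  have hnorm : ‖(g : (E d × E d) →L[ℝ] (E d × E d))‖ ≤ 1 := by
    refine ContinuousLinearMap.opNorm_le_bound _ zero_le_one fun q => ?_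
    rw [one_mul]
    change ‖g q‖ ≤ ‖q‖
    rw [hg, Prod.norm_def, Prod.norm_def]
    refine max_le_max le_rfl ?_
    rw [norm_smul, norm_inv, norm_norm]
    exact mul_le_of_le_one_left (norm_nonneg _) (inv_le_one_of_one_le₀ hv)
  have h := g.iteratedFDerivWithin_comp_right (rayExt φ.1) uniqueDiffOn_univ (x := (x, v))
    (Set.mem_univ _) j
  rw [Set.preimage_univ, iteratedFDerivWithin_univ, iteratedFDerivWithin_univ] at h
  rw [hcomp] at h
  rw [h]
  refine (ContinuousMultilinearMap.norm_compContinuousLinearMap_le _ _).trans ?_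
  refine (mul_le_of_le_one_right (norm_nonneg _)
    (Finset.prod_le_one (fun _ _ => norm_nonneg _) fun _ _ => hnorm)).trans ?_
  exact norm_iteratedFDeriv_rayExt_sphere_le hj φ x ⟨dir v, by simpa using norm_dir hvne⟩

theorem contDiffAt_rayExt_right (φ : SmoothFn d) (x : E d) {v : E d} (hv : v ≠ 0) :
    ContDiffAt ℝ ∞ (fun v => rayExt φ.1 (x, v)) v :=
  (contDiffAt_rayExt φ (x, v) hv).comp v (contDiffAt_const.prodMk contDiffAt_id)

theorem norm_iteratedFDeriv_rayExt_right_le {j N : ℕ} (hj : j ≤ N) (φ : SmoothFn d) (x : E d)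
    {v : E d} (hv : 1 ≤ ‖v‖) :
    ‖iteratedFDeriv ℝ j (fun v => rayExt φ.1 (x, v)) v‖ ≤ cnorm N φ := by
  have hv0 : v ≠ 0 := norm_pos_iff.1 (one_pos.trans_le hv)
  -- Translating by `(x, 0)` makes restriction to the fibre over `x` a composition with the linear
  -- map `inr`, of norm at most 1.
  let f : E d × E d → ℂ := fun q => rayExt φ.1 (q + (x, 0))
  have hf : ∀ q : E d × E d, q.2 ≠ 0 → ContDiffAt ℝ ∞ f q := fun q hq =>
    (contDiffAt_rayExt φ (q + (x, 0)) (by simpa using hq)).comp q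
      (contDiffAt_id.add contDiffAt_const)
  have hs : IsOpen {q : E d × E d | q.2 ≠ 0} := isOpen_ne_fun continuous_snd continuous_const
  let g := ContinuousLinearMap.inr ℝ (E d) (E d)
  have hs' : IsOpen (g ⁻¹' {q : E d × E d | q.2 ≠ 0}) := hs.preimage g.continuous
  have h := g.iteratedFDerivWithin_comp_right (n := ∞) (f := f)
    (s := {q : E d × E d | q.2 ≠ 0}) (fun q hq => (hf q hq).contDiffWithinAt)
    hs.uniqueDiffOn hs'.uniqueDiffOn (x := v) hv0 (i := j) (mod_cast le_top)
  rw [iteratedFDerivWithin_of_isOpen _ hs' hv0, iteratedFDerivWithin_of_isOpen _ hs hv0] at h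
  have hfg : f ∘ g = fun v => rayExt φ.1 (x, v) := by
    funext w
    simp [f, g]
  rw [hfg] at h
  rw [h]
  refine (ContinuousMultilinearMap.norm_compContinuousLinearMap_le _ _).trans ?_
  refine (mul_le_of_le_one_right (norm_nonneg _)
    (Finset.prod_le_one (fun _ _ => norm_nonneg _) fun _ _ =>
      ContinuousLinearMap.norm_inr_le_one ℝ (E d) (E d))).trans ?_
  have h2 := iteratedFDeriv_comp_add_right (𝕜 := ℝ) (f := rayExt φ.1) j ((x, 0) : E d × E d) (g v)
  rw [h2]
  simpa [g] using norm_iteratedFDeriv_rayExt_le hj φ x hv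

theorem exists_isAmplitude_rayExt (N : ℕ) : ∃ c : ℝ, 0 ≤ c ∧ ∀ (φ ψ : SmoothFn d) (x y : E d),
    IsAmplitude N (c * cnorm N φ * cnorm N ψ)
      (fun v => rayExt φ.1 (x, v) * (rayExt ψ.1 (y, v) * cutoff v)) := by
  obtain ⟨A, hA⟩ := exists_isAmplitude_cutoff (E := E d) N
  have hA0 := hA.nonneg
  refine ⟨2 ^ N * 2 ^ N * A, by positivity, fun φ ψ x y => ?_⟩
  have h := (hA.mul (fun v hv => contDiffAt_rayExt_right ψ y hv)
    (fun j hj v hv => norm_iteratedFDeriv_rayExt_right_le hj ψ y hv.1) (cnorm_nonneg N ψ)).mul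
    (fun v hv => contDiffAt_rayExt_right φ x hv)
    (fun j hj v hv => norm_iteratedFDeriv_rayExt_right_le hj φ x hv.1) (cnorm_nonneg N φ)
  convert h using 1
  ring

theorem cnorm_add_le (N : ℕ) (φ ψ : SmoothFn d) : cnorm N (φ + ψ) ≤ cnorm N φ + cnorm N ψ := by
  refine cnorm_le (add_nonneg (cnorm_nonneg _ _) (cnorm_nonneg _ _)) fun j hj x θ => ?_
  have h : rayExt (φ + ψ).1 = rayExt φ.1 + rayExt ψ.1 := by
    funext q
    by_cases hq : q.2 = 0 <;> simp [rayExt, hq]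
  have hφ := contDiffAt_rayExt φ (x, (θ : E d)) (sphere_ne_zero θ)
  have hψ := contDiffAt_rayExt ψ (x, (θ : E d)) (sphere_ne_zero θ)
  rw [h, iteratedFDeriv_add_apply (hφ.of_le (mod_cast le_top)) (hψ.of_le (mod_cast le_top))]
  exact (norm_add_le _ _).trans (add_le_add (norm_iteratedFDeriv_rayExt_sphere_le hj φ x θ)
    (norm_iteratedFDeriv_rayExt_sphere_le hj ψ x θ))

theorem cnorm_neg (N : ℕ) (φ : SmoothFn d) : cnorm N (-φ) = cnorm N φ := by
  have h : rayExt (-φ).1 = -rayExt φ.1 := by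
    funext q
    by_cases hq : q.2 = 0 <;> simp [rayExt, hq]
  simp only [cnorm, ckNorm, h, iteratedFDeriv_neg_apply, enorm_neg]

theorem cnorm_zero (N : ℕ) : cnorm N (0 : SmoothFn d) = 0 := by
  refine le_antisymm (cnorm_le le_rfl fun j _ x θ => ?_) (cnorm_nonneg _ _)
  have h : rayExt (0 : SmoothFn d).1 = fun _ => 0 := by
    funext q
    by_cases hq : q.2 = 0 <;> simp [rayExt, hq]
  rw [h, iteratedFDeriv_fun_zero]
  simp

theorem cnorm_sum_le {ι : Type*} (N : ℕ) (s : Finset ι) (f : ι → SmoothFn d) :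
    cnorm N (∑ i ∈ s, f i) ≤ ∑ i ∈ s, cnorm N (f i) :=
  Finset.le_sum_of_subadditive (cnorm N) (cnorm_zero N).le (cnorm_add_le N) s f

theorem hasDerivAt_rayExt_translate (φ : SmoothFn d) (e x : E d) {v : E d} (hv : v ≠ 0) :
    HasDerivAt (fun t : ℝ => rayExt φ.1 (x + t • e, v)) (fderiv ℝ (rayExt φ.1) (x, v) (e, 0)) 0 := by
  have hd := ((contDiffAt_rayExt φ (x, v) hv).differentiableAt (by simp)).hasFDerivAt
  have hc : HasDerivAt (fun t : ℝ => (x + t • e, v)) (e, (0 : E d)) 0 := by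
    refine HasDerivAt.prodMk ?_ (hasDerivAt_const _ _)
    simpa using ((hasDerivAt_id (0 : ℝ)).smul_const e).const_add x
  exact HasFDerivAt.comp_hasDerivAt_of_eq (l := rayExt φ.1) (0 : ℝ) hd hc (by simp)

theorem translate_eq_rayExt (φ : SmoothFn d) (e x : E d) (θ : Sph d) (t : ℝ) :
    φ.1 (proj x + proj (t • e), θ) = rayExt φ.1 (x + t • e, (θ : E d)) := by
  rw [rayExt_sphere, proj_add]

/-- The derivative `e · ∂_x` on `C^∞(S𝕋^d)`, for a fixed vector `e`. -/
def constDeriv (e : E d) (φ : SmoothFn d) : SmoothFn d :=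
  ⟨fun p => deriv (fun t : ℝ => φ.1 (p.1 + proj (t • e), p.2)) 0, by
    have h : lift (fun p : UnitBundle d => deriv (fun t : ℝ => φ.1 (p.1 + proj (t • e), p.2)) 0) =
        (fun q : E d × E d => fderiv ℝ (rayExt φ.1) q (e, 0)) ∘
          fun p : E d × Sph d => (p.1, (p.2 : E d)) := by
      funext p
      simp only [lift, Function.comp_apply, translate_eq_rayExt]
      exact (hasDerivAt_rayExt_translate φ e p.1 (sphere_ne_zero p.2)).deriv
    change ContMDiff _ _ _ (lift _)
    rw [h]
    intro p
    have h1 : ContDiffAt ℝ ∞ (fun q : E d × E d => fderiv ℝ (rayExt φ.1) q (e, 0))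
        (p.1, (p.2 : E d)) :=
      ((contDiffAt_rayExt φ _ (sphere_ne_zero p.2)).fderiv_right (m := ∞) (by simp)).clm_apply
        contDiffAt_const
    have h2 : ContMDiff (𝓘(ℝ, E d).prod (𝓡 (d - 1))) 𝓘(ℝ, E d × E d) ∞
        fun p : E d × Sph d => (p.1, (p.2 : E d)) :=
      contMDiff_fst.prodMk_space (contMDiff_coe_sphere.comp contMDiff_snd)
    exact h1.contMDiffAt.comp p (h2 p)⟩

theorem constDeriv_proj (e : E d) (φ : SmoothFn d) (x : E d) (θ : Sph d) :
    (constDeriv e φ).1 (proj x, θ) = fderiv ℝ (rayExt φ.1) (x, (θ : E d)) (e, 0) := by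
  simp only [constDeriv, translate_eq_rayExt]
  exact (hasDerivAt_rayExt_translate φ e x (sphere_ne_zero θ)).deriv

theorem rayExt_translate (φ : SmoothFn d) (e : E d) (t : ℝ) (x : E d) (v : E d) (hv : v ≠ 0) :
    rayExt φ.1 (x + t • e, v) = φ.1 (proj x + proj (t • e), ⟨dir v, by simpa using norm_dir hv⟩) := by
  rw [rayExt_of_ne _ hv, proj_add]

theorem rayExt_constDeriv (e : E d) (φ : SmoothFn d) (x : E d) {v : E d} (hv : v ≠ 0) :
    rayExt (constDeriv e φ).1 (x, v) = fderiv ℝ (rayExt φ.1) (x, v) (e, 0) := by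
  rw [← (hasDerivAt_rayExt_translate φ e x hv).deriv, rayExt_of_ne x hv]
  simp only [rayExt_translate φ e _ x v hv]
  rfl

theorem hasDerivAt_translate (e : E d) (φ : SmoothFn d) (x : Torus d) (θ : Sph d) (t : ℝ) :
    HasDerivAt (fun t : ℝ => φ.1 (x + proj (t • e), θ))
      ((constDeriv e φ).1 (x + proj (t • e), θ)) t := by
  obtain ⟨y, rfl⟩ := surjective_proj x
  have h1 := hasDerivAt_rayExt_translate φ e (y + t • e) (sphere_ne_zero θ)
  rw [← constDeriv_proj, proj_add, ← sub_self t] at h1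
  refine (HasDerivAt.comp_sub_const t t h1).congr_of_eventuallyEq (.of_forall fun u => ?_)
  simp only [translate_eq_rayExt]
  congr 2
  module

theorem cnorm_constDeriv_le (N : ℕ) (e : E d) (φ : SmoothFn d) :
    cnorm N (constDeriv e φ) ≤ ‖e‖ * cnorm (N + 1) φ := by
  refine cnorm_le (mul_nonneg (norm_nonneg _) (cnorm_nonneg _ _)) fun j hj x θ => ?_
  have hθ := sphere_ne_zero θ
  have hev : rayExt (constDeriv e φ).1 =ᶠ[𝓝 (x, (θ : E d))]
      fun q => fderiv ℝ (rayExt φ.1) q (e, 0) := by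
    have hs : IsOpen {q : E d × E d | q.2 ≠ 0} := isOpen_ne_fun continuous_snd continuous_const
    filter_upwards [hs.mem_nhds hθ] with q hq using rayExt_constDeriv e φ q.1 hq
  rw [(hev.iteratedFDeriv ℝ j).eq_of_nhds]
  have hc := (contDiffAt_rayExt φ (x, (θ : E d)) hθ).fderiv_right (m := ∞) (by simp)
  refine (norm_iteratedFDeriv_clm_apply_const hc (mod_cast le_top)).trans ?_
  rw [norm_iteratedFDeriv_fderiv]
  have : ‖((e, 0) : E d × E d)‖ = ‖e‖ := by simp [Prod.norm_def]
  rw [this]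
  gcongr
  exact norm_iteratedFDeriv_rayExt_sphere_le (by omega) φ x θ

/-- The operator `1 - Δ_x` on `C^∞(S𝕋^d)`. -/
def oneSubLaplacian (φ : SmoothFn d) : SmoothFn d :=
  φ + -∑ i, constDeriv (EuclideanSpace.single i 1) (constDeriv (EuclideanSpace.single i 1) φ)

theorem cnorm_oneSubLaplacian_le (N : ℕ) (φ : SmoothFn d) :
    cnorm N (oneSubLaplacian φ) ≤ (1 + d) * cnorm (N + 2) φ := by
  refine (cnorm_add_le _ _ _).trans ?_
  rw [cnorm_neg, add_mul, one_mul]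
  refine add_le_add (cnorm_mono (by omega) φ) ((cnorm_sum_le _ _ _).trans ?_)
  calc _ ≤ ∑ _i : Fin d, cnorm (N + 2) φ := by
        refine Finset.sum_le_sum fun i _ => ?_
        refine (cnorm_constDeriv_le _ _ _).trans ?_
        refine (mul_le_mul_of_nonneg_left (cnorm_constDeriv_le _ _ _) (norm_nonneg _)).trans ?_
        simp
    _ = d * cnorm (N + 2) φ := by simp

theorem cnorm_iterate_oneSubLaplacian_le (M N : ℕ) (φ : SmoothFn d) :
    cnorm N (oneSubLaplacian^[M] φ) ≤ (1 + d) ^ M * cnorm (N + 2 * M) φ := by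
  induction M generalizing N with
  | zero => simp
  | succ M ih =>
    rw [Function.iterate_succ_apply']
    refine (cnorm_oneSubLaplacian_le _ _).trans ?_
    refine (mul_le_mul_of_nonneg_left (ih (N + 2)) (by positivity)).trans (le_of_eq ?_)
    rw [pow_succ, show N + 2 + 2 * M = N + 2 * (M + 1) by ring]
    ring

end CkNorm

/-! ### Fourier series in `x` -/

section Fourier

open MeasureTheory Filter Topology

variable {d : ℕ}

/-- The rescaling `ℝ^d / ℤ^d ≃ 𝕋^d`. -/
def rescale (d : ℕ) : UnitAddTorus (Fin d) ≃ₜ Torus d :=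
  Homeomorph.piCongrRight fun _ =>
    AddCircle.homeomorphAddCircle 1 (2 * Real.pi) one_ne_zero Real.two_pi_pos.ne'

theorem rescale_add (x y : UnitAddTorus (Fin d)) : rescale d (x + y) = rescale d x + rescale d y := by
  funext i
  exact map_add (AddCircle.equivAddCircle 1 (2 * Real.pi) one_ne_zero Real.two_pi_pos.ne') _ _

theorem rescale_symm_add (x y : Torus d) :
    (rescale d).symm (x + y) = (rescale d).symm x + (rescale d).symm y := by
  apply (rescale d).injective
  simp [rescale_add]

/-- The Haar probability measure of `𝕋^d`. -/
def torusHaar (d : ℕ) : Measure (Torus d) :=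
  (Measure.pi fun _ : Fin d => AddCircle.haarAddCircle (T := 1)).map (rescale d)

theorem measurePreserving_rescale : MeasurePreserving (rescale d)
    (Measure.pi fun _ : Fin d => AddCircle.haarAddCircle (T := 1)) (torusHaar d) :=
  ⟨(rescale d).measurable, rfl⟩

instance : IsProbabilityMeasure (torusHaar d) :=
  Measure.isProbabilityMeasure_map (rescale d).measurable.aemeasurable

theorem integral_torusHaar (f : Torus d → ℂ) : ∫ x, f x ∂(torusHaar d) =
    ∫ y, f (rescale d y) ∂(Measure.pi fun _ : Fin d => AddCircle.haarAddCircle (T := 1)) :=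
  (measurePreserving_rescale.integral_comp (rescale d).measurableEmbedding f).symm

theorem integral_torusHaar_add (f : Torus d → ℂ) (a : Torus d) :
    ∫ x, f (x + a) ∂(torusHaar d) = ∫ x, f x ∂(torusHaar d) := by
  obtain ⟨b, rfl⟩ := (rescale d).surjective a
  rw [integral_torusHaar, integral_torusHaar]
  simp only [← rescale_add]
  exact integral_add_right_eq_self (fun y => f (rescale d y)) b

theorem integrable_torusHaar {f : Torus d → ℂ} (hf : Continuous f) : Integrable f (torusHaar d) :=
  hf.integrable_of_hasCompactSupport (HasCompactSupport.of_compactSpace f)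

/-- The frequency vector in `ℝ^d` of an index `n ∈ ℤ^d`. -/
def freq (n : Fin d → ℤ) : E d := WithLp.toLp 2 fun i => (n i : ℝ)

/-- The character of `𝕋^d` of index `n`. -/
def torusChar (n : Fin d → ℤ) (x : Torus d) : ℂ := UnitAddTorus.mFourier n ((rescale d).symm x)

theorem continuous_torusChar (n : Fin d → ℤ) : Continuous (torusChar n) :=
  (UnitAddTorus.mFourier n).continuous.comp (rescale d).symm.continuous

theorem norm_torusChar (n : Fin d → ℤ) (x : Torus d) : ‖torusChar n x‖ = 1 := by
  simp only [torusChar, UnitAddTorus.mFourier, ContinuousMap.coe_mk, norm_prod, fourier_apply]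
  exact Finset.prod_eq_one fun i _ => Circle.norm_coe _

theorem torusChar_add (n : Fin d → ℤ) (x y : Torus d) :
    torusChar n (x + y) = torusChar n x * torusChar n y := by
  simp only [torusChar, rescale_symm_add, UnitAddTorus.mFourier, ContinuousMap.coe_mk, Pi.add_apply,
    fourier_apply, smul_add, AddCircle.toCircle_add, Circle.coe_mul, Finset.prod_mul_distrib]

theorem torusChar_proj (n : Fin d → ℤ) (x : E d) :
    torusChar n (proj x) = Complex.exp (Complex.I * (inner ℝ (freq n) x : ℝ)) := by
  have h : ∀ i, (rescale d).symm (proj x) i = ((x i * ((2 * Real.pi)⁻¹ * 1) : ℝ) : UnitAddCircle) :=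
    fun i => AddCircle.homeomorphAddCircle_symm_apply_mk 1 (2 * Real.pi) one_ne_zero
      Real.two_pi_pos.ne' (x i)
  simp only [torusChar, UnitAddTorus.mFourier, ContinuousMap.coe_mk, h, fourier_coe_apply]
  rw [← Complex.exp_sum]
  congr 1
  simp only [PiLp.inner_apply, freq, Complex.ofReal_sum, Finset.mul_sum]
  refine Finset.sum_congr rfl fun i _ => ?_
  have hpi : (Real.pi : ℂ) ≠ 0 := by exact_mod_cast Real.pi_ne_zero
  simp
  field_simp

theorem freq_neg (n : Fin d → ℤ) : freq (-n) = -freq n := by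
  ext i; simp [freq]

theorem norm_freq_sq (n : Fin d → ℤ) : ‖freq n‖ ^ 2 = ∑ i, (n i : ℝ) ^ 2 := by
  simp [EuclideanSpace.norm_sq_eq, freq]

theorem injective_freq : Function.Injective (freq : (Fin d → ℤ) → E d) := by
  intro m n h
  funext i
  have := congrArg (fun v : E d => v i) h
  simpa [freq] using this

/-- Comparison with the lattice sum of `‖ξ‖^{-2r}` over `ℤ^d`, for all terms except `n = 0`. -/
theorem summable_freq (r : ℕ) (hr : d < 2 * r) :
    Summable fun n : Fin d → ℤ => ((1 + ‖freq n‖ ^ 2) ^ r)⁻¹ := by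
  let b := (EuclideanSpace.basisFun (Fin d) ℝ).toBasis
  let L := Submodule.span ℤ (Set.range b)
  have hmem : ∀ n : Fin d → ℤ, freq n ∈ L := fun n => by
    have : freq n = ∑ i, n i • b i := by
      ext j
      simp [freq, b, Finset.sum_apply, Pi.single_apply]
    rw [this]
    exact Submodule.sum_mem _ fun i _ => Submodule.smul_mem _ _ (Submodule.subset_span ⟨i, rfl⟩)
  have hfin : Module.finrank ℤ L = d := by
    rw [ZLattice.rank ℝ L]; simp
  have h1 := ZLattice.summable_norm_rpow L (-(2 * r : ℕ)) (by
    rw [hfin]; exact neg_lt_neg (by exact_mod_cast hr))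
  have h2 := h1.comp_injective (i := fun n : Fin d → ℤ => (⟨freq n, hmem n⟩ : L))
    fun m n h => injective_freq (congrArg Subtype.val h)
  refine Summable.of_norm_bounded_eventually h2 ?_
  have h0 : ({0}ᶜ : Set (Fin d → ℤ)) ∈ (cofinite : Filter (Fin d → ℤ)) :=
    (Set.finite_singleton _).compl_mem_cofinite
  filter_upwards [h0] with n hn
  have hpos : 0 < ‖freq n‖ := by
    rw [norm_pos_iff]
    intro h
    refine hn (injective_freq ?_)
    rw [h]; ext i; simp [freq]
  have e : (‖(⟨freq n, hmem n⟩ : L)‖ : ℝ) = ‖freq n‖ := rfl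
  simp only [Function.comp_apply, e]
  rw [Real.rpow_neg hpos.le, Real.rpow_natCast, pow_mul, Real.norm_of_nonneg (by positivity)]
  gcongr
  linarith

variable [NeZero d]

/-- The Fourier coefficients in `x` of a smooth function of `(x, θ)`. -/
def fcoeff (n : Fin d → ℤ) (φ : SmoothFn d) (θ : Sph d) : ℂ :=
  ∫ x, torusChar (-n) x * φ.1 (x, θ) ∂(torusHaar d)

theorem continuous_section (φ : SmoothFn d) (θ : Sph d) : Continuous fun x => φ.1 (x, θ) :=
  φ.continuous.comp (Continuous.prodMk_left θ)

theorem norm_fcoeff_le (N : ℕ) (n : Fin d → ℤ) (φ : SmoothFn d) (θ : Sph d) :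
    ‖fcoeff n φ θ‖ ≤ cnorm N φ := by
  have h := norm_integral_le_of_norm_le_const (μ := torusHaar d) (C := cnorm N φ)
    (f := fun x => torusChar (-n) x * φ.1 (x, θ)) (.of_forall fun x => by
      rw [norm_mul, norm_torusChar, one_mul]; exact norm_le_cnorm N φ _)
  rw [fcoeff]
  simpa using h

theorem fcoeff_add (n : Fin d → ℤ) (φ ψ : SmoothFn d) (θ : Sph d) :
    fcoeff n (φ + ψ) θ = fcoeff n φ θ + fcoeff n ψ θ := by
  have h := integral_add
    (integrable_torusHaar ((continuous_torusChar (-n)).mul (continuous_section φ θ)))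
    (integrable_torusHaar ((continuous_torusChar (-n)).mul (continuous_section ψ θ)))
  unfold fcoeff
  refine Eq.trans ?_ h
  refine integral_congr_ae (.of_forall fun x => ?_)
  simp [mul_add]

theorem fcoeff_neg (n : Fin d → ℤ) (φ : SmoothFn d) (θ : Sph d) :
    fcoeff n (-φ) θ = -fcoeff n φ θ := by
  unfold fcoeff
  rw [← integral_neg]
  simp

theorem fcoeff_sum {ι : Type*} (n : Fin d → ℤ) (s : Finset ι) (f : ι → SmoothFn d) (θ : Sph d) :
    fcoeff n (∑ i ∈ s, f i) θ = ∑ i ∈ s, fcoeff n (f i) θ := by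
  classical
  induction s using Finset.induction_on with
  | empty => simp [fcoeff]
  | insert a s ha ih => rw [Finset.sum_insert ha, Finset.sum_insert ha, fcoeff_add, ih]

/-- Translation by `te` multiplies the coefficient by `e^{it ξ·e}`, by invariance of Haar measure;
differentiating at `t = 0` under the integral and in closed form gives the identity. -/
theorem fcoeff_constDeriv (n : Fin d → ℤ) (e : E d) (φ : SmoothFn d) (θ : Sph d) :
    fcoeff n (constDeriv e φ) θ = Complex.I * (inner ℝ (freq n) e : ℝ) * fcoeff n φ θ := by
  have key := (hasDerivAt_integral_of_dominated_loc_of_deriv_le (μ := torusHaar d) (𝕜 := ℝ)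
    (F := fun t x => torusChar (-n) x * φ.1 (x + proj (t • e), θ))
    (F' := fun t x => torusChar (-n) x * (constDeriv e φ).1 (x + proj (t • e), θ))
    (x₀ := 0) (s := Set.univ) (bound := fun _ => cnorm 0 (constDeriv e φ)) univ_mem
    (.of_forall fun u => ((continuous_torusChar (-n)).mul ((continuous_section φ θ).comp
      (continuous_add_const _))).aestronglyMeasurable)
    (integrable_torusHaar ((continuous_torusChar (-n)).mul ((continuous_section φ θ).comp
      (continuous_add_const _))))
    ((continuous_torusChar (-n)).mul ((continuous_section (constDeriv e φ) θ).comp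
      (continuous_add_const _))).aestronglyMeasurable
    (.of_forall fun x u _ => by
      rw [norm_mul, norm_torusChar, one_mul]; exact norm_le_cnorm 0 _ _)
    (integrable_const _)
    (.of_forall fun x u _ => (hasDerivAt_translate e φ x θ u).const_mul _)).2
  simp only [zero_smul, proj_zero, add_zero] at key
  have hF : ∀ t : ℝ, ∫ x, torusChar (-n) x * φ.1 (x + proj (t • e), θ) ∂(torusHaar d) =
      Complex.exp (t * (Complex.I * (inner ℝ (freq n) e : ℝ))) * fcoeff n φ θ := by
    intro t
    rw [fcoeff, ← integral_torusHaar_add (fun x => torusChar (-n) x * φ.1 (x, θ)) (proj (t • e)),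
      ← integral_const_mul]
    refine integral_congr_ae (.of_forall fun x => ?_)
    simp only [torusChar_add, torusChar_proj, freq_neg, inner_neg_left, real_inner_smul_right]
    have : Complex.exp (t * (Complex.I * (inner ℝ (freq n) e : ℝ))) *
        Complex.exp (Complex.I * ((-(t * inner ℝ (freq n) e) : ℝ) : ℂ)) = 1 := by
      rw [← Complex.exp_add, Complex.exp_eq_one_iff]
      exact ⟨0, by push_cast; ring⟩
    linear_combination (-(torusChar (-n) x * φ.1 (x + proj (t • e), θ))) * this
  simp only [hF] at key
  have h2 : HasDerivAt (fun t : ℝ =>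
      Complex.exp (t * (Complex.I * (inner ℝ (freq n) e : ℝ))) * fcoeff n φ θ)
      (Complex.I * (inner ℝ (freq n) e : ℝ) * fcoeff n φ θ) 0 := by
    have h3 : HasDerivAt (fun t : ℝ => (t : ℂ) * (Complex.I * (inner ℝ (freq n) e : ℝ)))
        (Complex.I * (inner ℝ (freq n) e : ℝ)) 0 := by
      simpa using (Complex.ofRealCLM.hasDerivAt (x := (0 : ℝ))).mul_const
        (Complex.I * (inner ℝ (freq n) e : ℝ) : ℂ)
    simpa using h3.cexp.mul_const (fcoeff n φ θ)
  exact key.unique h2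

theorem fcoeff_oneSubLaplacian (n : Fin d → ℤ) (φ : SmoothFn d) (θ : Sph d) :
    fcoeff n (oneSubLaplacian φ) θ = ((1 + ‖freq n‖ ^ 2 : ℝ) : ℂ) * fcoeff n φ θ := by
  have h : ∀ i, inner ℝ (freq n) (EuclideanSpace.single i (1 : ℝ)) = (n i : ℝ) := fun i => by
    rw [EuclideanSpace.inner_single_right]
    simp [freq]
  rw [oneSubLaplacian, fcoeff_add, fcoeff_neg, fcoeff_sum, norm_freq_sq]
  simp only [fcoeff_constDeriv, h]
  push_cast
  rw [add_mul, Finset.sum_mul, one_mul, ← Finset.sum_neg_distrib]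
  congr 1
  refine Finset.sum_congr rfl fun i _ => ?_
  linear_combination (-(n i : ℂ) ^ 2 * fcoeff n φ θ) * Complex.I_mul_I

theorem fcoeff_iterate_oneSubLaplacian (M : ℕ) (n : Fin d → ℤ) (φ : SmoothFn d) (θ : Sph d) :
    fcoeff n (oneSubLaplacian^[M] φ) θ = ((1 + ‖freq n‖ ^ 2 : ℝ) : ℂ) ^ M * fcoeff n φ θ := by
  induction M with
  | zero => simp
  | succ M ih => rw [Function.iterate_succ_apply', fcoeff_oneSubLaplacian, ih, pow_succ]; ring

/-- The source of all decay in the frequency: `2M` derivatives of `φ` buy a factor `(1 +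
‖ξ‖²)^{-M}`. -/
theorem fcoeff_eq (M : ℕ) (n : Fin d → ℤ) (φ : SmoothFn d) (θ : Sph d) :
    fcoeff n φ θ =
      (((1 + ‖freq n‖ ^ 2) ^ M : ℝ) : ℂ)⁻¹ * fcoeff n (oneSubLaplacian^[M] φ) θ := by
  have : (((1 + ‖freq n‖ ^ 2) ^ M : ℝ) : ℂ) ≠ 0 := by
    have : (1 + ‖freq n‖ ^ 2) ^ M ≠ 0 := by positivity
    exact_mod_cast this
  rw [fcoeff_iterate_oneSubLaplacian, ← Complex.ofReal_pow, inv_mul_cancel_left₀ this]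

theorem norm_fcoeff_le_inv (M : ℕ) (n : Fin d → ℤ) (φ : SmoothFn d) (θ : Sph d) :
    ‖fcoeff n φ θ‖ ≤ ((1 + ‖freq n‖ ^ 2) ^ M)⁻¹ * cnorm 0 (oneSubLaplacian^[M] φ) := by
  rw [fcoeff_eq M, norm_mul, norm_inv, Complex.norm_real, Real.norm_of_nonneg (by positivity)]
  gcongr
  exact norm_fcoeff_le 0 _ _ _

theorem hasSum_fcoeff (φ : SmoothFn d) (x : Torus d) (θ : Sph d) :
    HasSum (fun n => fcoeff n φ θ * torusChar n x) (φ.1 (x, θ)) := by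
  let f : C(UnitAddTorus (Fin d), ℂ) :=
    ⟨fun y => φ.1 (rescale d y, θ), (continuous_section φ θ).comp (rescale d).continuous⟩
  have hc : ∀ n, UnitAddTorus.mFourierCoeff f n = fcoeff n φ θ := fun n => by
    rw [fcoeff, integral_torusHaar]
    simp only [torusChar, Homeomorph.symm_apply_apply]
    rfl
  have hs : Summable (UnitAddTorus.mFourierCoeff f) := by
    refine Summable.of_norm_bounded
      ((summable_freq d (by have := NeZero.pos d; omega)).mul_right
        (cnorm 0 (oneSubLaplacian^[d] φ))) fun n => ?_
    rw [hc]
    exact norm_fcoeff_le_inv d n φ θ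
  have h := UnitAddTorus.hasSum_mFourier_series_apply_of_summable hs ((rescale d).symm x)
  simp only [hc, smul_eq_mul] at h
  simpa [f, torusChar] using h

end Fourier

/-! ### Laplace transforms and the mode expansion of the resolvent -/

section Laplace

open MeasureTheory Filter Topology Set

theorem norm_pow_mul_exp_le {k : ℕ} {s : ℂ} {ε t : ℝ} (ht : 0 < t) (hs : ε ≤ s.re) :
    ‖(-(t : ℂ)) ^ k * Complex.exp (-s * t)‖ ≤ t ^ k * Real.exp (-ε * t) := by
  rw [norm_mul, norm_pow, norm_neg, Complex.norm_real, Real.norm_of_nonneg ht.le, Complex.norm_exp]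
  gcongr
  simp only [Complex.mul_re, Complex.neg_re, Complex.ofReal_re, Complex.ofReal_im, mul_zero,
    sub_zero]
  nlinarith

theorem integrableOn_pow_mul_exp (k : ℕ) {ε : ℝ} (hε : 0 < ε) :
    IntegrableOn (fun t : ℝ => t ^ k * Real.exp (-ε * t)) (Ioi 0) := by
  have h := integrableOn_rpow_mul_exp_neg_mul_rpow (p := 1) (s := k) (b := ε)
    (by linarith [(Nat.cast_nonneg k : (0 : ℝ) ≤ k)]) one_pos hε
  simpa using h

theorem continuous_pow_mul_exp (k : ℕ) (s : ℂ) :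
    Continuous fun t : ℝ => (-(t : ℂ)) ^ k * Complex.exp (-s * t) := by fun_prop

theorem integrableOn_pow_mul_cexp (k : ℕ) {s : ℂ} (hs : 0 < s.re) :
    IntegrableOn (fun t : ℝ => (-(t : ℂ)) ^ k * Complex.exp (-s * t)) (Ioi 0) := by
  refine (integrableOn_pow_mul_exp k hs).mono'
    (continuous_pow_mul_exp k s).aestronglyMeasurable ?_
  filter_upwards [ae_restrict_mem measurableSet_Ioi] with t ht
  exact norm_pow_mul_exp_le ht le_rfl

theorem integrableOn_laplace (k : ℕ) {s : ℂ} (hs : 0 < s.re) {F : ℝ → ℂ} (hF : Continuous F)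
    {B : ℝ} (hB : ∀ t, ‖F t‖ ≤ B) :
    IntegrableOn (fun t : ℝ => (-(t : ℂ)) ^ k * Complex.exp (-s * t) * F t) (Ioi 0) :=
  (integrableOn_pow_mul_cexp k hs).mul_bdd hF.aestronglyMeasurable (.of_forall hB)

theorem isDerivChain_laplace {F : ℝ → ℂ} (hF : Continuous F) {B : ℝ} (hB : ∀ t, ‖F t‖ ≤ B) :
    IsDerivChain fun k s =>
      ∫ t in Ioi (0 : ℝ), (-(t : ℂ)) ^ k * Complex.exp (-s * t) * F t := by
  intro k s hs
  have hs' : 0 < s.re := hs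
  -- On this neighbourhood the integrands are dominated by a single decaying exponential of rate `Re
  -- s / 2`.
  have hnhds : {z : ℂ | s.re / 2 < z.re} ∈ 𝓝 s :=
    (isOpen_lt continuous_const Complex.continuous_re).mem_nhds (half_lt_self hs')
  refine (hasDerivAt_integral_of_dominated_loc_of_deriv_le (𝕜 := ℂ)
    (F := fun s (t : ℝ) => (-(t : ℂ)) ^ k * Complex.exp (-s * t) * F t)
    (F' := fun s (t : ℝ) => (-(t : ℂ)) ^ (k + 1) * Complex.exp (-s * t) * F t)
    (bound := fun t => t ^ (k + 1) * Real.exp (-(s.re / 2) * t) * B) hnhds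
    (.of_forall fun z => ((continuous_pow_mul_exp k z).mul hF).aestronglyMeasurable)
    (integrableOn_laplace k hs hF hB)
    ((continuous_pow_mul_exp (k + 1) s).mul hF).aestronglyMeasurable ?_
    ((integrableOn_pow_mul_exp (k + 1) (half_pos hs')).mul_const B) ?_).2
  · filter_upwards [ae_restrict_mem measurableSet_Ioi] with t ht z hz
    rw [norm_mul]
    have ht' : (0 : ℝ) < t := ht
    exact mul_le_mul (norm_pow_mul_exp_le ht (le_of_lt hz)) (hB t) (norm_nonneg _) (by positivity)
  · refine .of_forall fun t z _ => ?_
    have h1 : HasDerivAt (fun z : ℂ => -z * t) (-(t : ℂ)) z := by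
      simpa using (hasDerivAt_id z).neg.mul_const (t : ℂ)
    refine ((h1.cexp.const_mul _).mul_const _).congr_deriv ?_
    ring

/-- Start from `∫ e^{-wt} dt = 1/w` and differentiate in `w`; both sides form a derivative chain. -/
theorem integral_pow_mul_cexp (k : ℕ) {w : ℂ} (hw : 0 < w.re) :
    ∫ t in Ioi (0 : ℝ), (-(t : ℂ)) ^ k * Complex.exp (-w * t) = invKernel (k + 2) w := by
  induction k generalizing w with
  | zero =>
    have h := integral_exp_mul_complex_Ioi (a := -w) (by simpa using hw) 0
    simp only [pow_zero, one_mul, h, invKernel]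
    simp
  | succ k ih =>
    have h1 := isDerivChain_laplace (F := fun _ => 1) continuous_const (B := 1) (by simp) k w hw
    simp only [mul_one] at h1
    have h2 : HasDerivAt (invKernel (k + 2))
        (∫ t in Ioi (0 : ℝ), (-(t : ℂ)) ^ (k + 1) * Complex.exp (-w * t)) w := by
      refine h1.congr_of_eventuallyEq ?_
      filter_upwards [isOpen_rightHalfPlane.mem_nhds hw] with z hz using (ih hz).symm
    exact h2.unique (hasDerivAt_invKernel (k + 2) hw)

variable {d : ℕ}

theorem phase_sphere (ξ : E d) (θ : Sph d) : phase ξ (θ : E d) = inner ℝ ξ (θ : E d) := by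
  have hn : ‖(θ : E d)‖ = 1 := by simp
  simp [phase, dir, hn]

theorem integrable_prod_laplace (k : ℕ) {s : ℂ} (hs : 0 < s.re) {G : ℝ × UnitBundle d → ℂ}
    (hG : Continuous G) {C : ℝ} (hC : ∀ q, ‖G q‖ ≤ C) :
    Integrable (fun q : ℝ × UnitBundle d => (-(q.1 : ℂ)) ^ k * Complex.exp (-s * q.1) * G q)
      ((volume.restrict (Ioi (0 : ℝ))).prod (liouville d)) := by
  have h := (integrableOn_pow_mul_cexp k hs).integrable.mul_prod
    (integrable_const (μ := liouville d) (1 : ℂ))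
  simp only [mul_one] at h
  exact h.mul_bdd hG.aestronglyMeasurable (.of_forall hC)

variable [NeZero d]

/-- The `k`-th derivative of `s ↦ ⟨L(s)φ, ψ⟩` in the right half-plane. -/
def resolventDeriv (φ ψ : SmoothFn d) (k : ℕ) (s : ℂ) : ℂ :=
  ∫ t in Ioi (0 : ℝ), (-(t : ℂ)) ^ k * Complex.exp (-s * t) * pairing (transport t φ).1 ψ.1

theorem isDerivChain_resolventDeriv (φ ψ : SmoothFn d) : IsDerivChain (resolventDeriv φ ψ) := by
  obtain ⟨B, hB⟩ := exists_bound_pairing_transport φ ψ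
  exact isDerivChain_laplace (continuous_pairing_transport φ ψ) hB

/-- The contribution of a frequency to the integrand of `⟨φ, ψ⟩`. -/
def mode (n : Fin d → ℤ) (φ ψ : SmoothFn d) (p : UnitBundle d) : ℂ :=
  fcoeff n φ p.2 * torusChar n p.1 * ψ.1 p

theorem continuous_fcoeff (n : Fin d → ℤ) (φ : SmoothFn d) : Continuous (fcoeff n φ) := by
  refine continuous_of_dominated (bound := fun _ => cnorm 0 φ) (fun θ =>
    ((continuous_torusChar (-n)).mul (continuous_section φ θ)).aestronglyMeasurable)
    (fun θ => .of_forall fun x => ?_) (integrable_const _) (.of_forall fun x => ?_)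
  · rw [norm_mul, norm_torusChar, one_mul]; exact norm_le_cnorm 0 φ _
  · exact continuous_const.mul (φ.continuous.comp (Continuous.prodMk_right x))

theorem continuous_mode (n : Fin d → ℤ) (φ ψ : SmoothFn d) : Continuous (mode n φ ψ) :=
  (((continuous_fcoeff n φ).comp continuous_snd).mul
    ((continuous_torusChar n).comp continuous_fst)).mul ψ.continuous

theorem norm_mode_le (M : ℕ) (n : Fin d → ℤ) (φ ψ : SmoothFn d) (p : UnitBundle d) :
    ‖mode n φ ψ p‖ ≤
      ((1 + ‖freq n‖ ^ 2) ^ M)⁻¹ * cnorm 0 (oneSubLaplacian^[M] φ) * cnorm 0 ψ := by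
  rw [mode, norm_mul, norm_mul, norm_torusChar, mul_one]
  exact mul_le_mul (norm_fcoeff_le_inv M n φ _) (norm_le_cnorm 0 ψ p) (norm_nonneg _)
    (mul_nonneg (by positivity) (cnorm_nonneg _ _))

/-- The time-dependent phase factor of a mode, times the mode. -/
def movingMode (n : Fin d → ℤ) (φ ψ : SmoothFn d) (q : ℝ × UnitBundle d) : ℂ :=
  Complex.exp (-(Complex.I * (phase (freq n) (q.2.2 : E d) : ℂ)) * q.1) * mode n φ ψ q.2

theorem norm_movingMode (n : Fin d → ℤ) (φ ψ : SmoothFn d) (q : ℝ × UnitBundle d) :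
    ‖movingMode n φ ψ q‖ = ‖mode n φ ψ q.2‖ := by
  rw [movingMode, norm_mul, Complex.norm_exp]
  simp

theorem continuous_movingMode (n : Fin d → ℤ) (φ ψ : SmoothFn d) :
    Continuous (movingMode n φ ψ) := by
  have h1 : Continuous fun q : ℝ × UnitBundle d => (phase (freq n) (q.2.2 : E d) : ℂ) := by
    simp only [phase_sphere]
    fun_prop
  have h2 : Continuous fun q : ℝ × UnitBundle d => mode n φ ψ q.2 :=
    (continuous_mode n φ ψ).comp continuous_snd
  have h3 : Continuous fun q : ℝ × UnitBundle d => (q.1 : ℂ) := by fun_prop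
  exact (Complex.continuous_exp.comp ((continuous_const.mul h1).neg.mul h3)).mul h2

theorem hasSum_movingMode (φ ψ : SmoothFn d) (t : ℝ) (p : UnitBundle d) :
    HasSum (fun n => movingMode n φ ψ (t, p)) ((transport t φ).1 p * ψ.1 p) := by
  have h := (hasSum_fcoeff φ (flow (-t) p).1 p.2).mul_right (ψ.1 p)
  refine h.congr_fun fun n => ?_
  simp only [flow, movingMode, mode, torusChar_add, torusChar_proj, phase_sphere,
    real_inner_smul_right]
  have : Complex.I * ((-t * inner ℝ (freq n) (p.2 : E d) : ℝ) : ℂ) =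
      -(Complex.I * (inner ℝ (freq n) (p.2 : E d) : ℝ)) * t := by push_cast; ring
  rw [this]
  ring

/-- The contribution of a frequency to `resolventDeriv`, after integration in time. -/
def modeInt (m : ℕ) (s : ℂ) (n : Fin d → ℤ) (φ ψ : SmoothFn d) : ℂ :=
  ∫ p, invKernel m (symb s (freq n) (p.2 : E d)) * mode n φ ψ p ∂(liouville d)

theorem integral_movingMode (k : ℕ) {s : ℂ} (hs : 0 < s.re) (n : Fin d → ℤ) (φ ψ : SmoothFn d) :
    ∫ q, (-(q.1 : ℂ)) ^ k * Complex.exp (-s * q.1) * movingMode n φ ψ q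
      ∂((volume.restrict (Ioi (0 : ℝ))).prod (liouville d)) = modeInt (k + 2) s n φ ψ := by
  rw [integral_prod_symm _ (integrable_prod_laplace k hs (continuous_movingMode n φ ψ)
    fun q => (norm_movingMode n φ ψ q).trans_le (norm_mode_le 0 n φ ψ q.2))]
  refine integral_congr_ae (.of_forall fun p => ?_)
  simp only
  rw [← integral_pow_mul_cexp k (w := symb s (freq n) (p.2 : E d)) (by rwa [symb_re]),
    ← integral_mul_const]
  refine integral_congr_ae (.of_forall fun t => ?_)
  simp only [movingMode, symb, neg_add, add_mul, Complex.exp_add]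
  ring

/-- The transported modes have the same modulus as the modes, which are summable uniformly over
`S𝕋^d`. For `Re s > 0` the sum over frequencies may therefore be exchanged with the integral in time
and on `S𝕋^d`. -/
theorem hasSum_modeInt (k : ℕ) {s : ℂ} (hs : 0 < s.re) (φ ψ : SmoothFn d) :
    HasSum (fun n => modeInt (k + 2) s n φ ψ) (resolventDeriv φ ψ k s) := by
  set μ := (volume.restrict (Ioi (0 : ℝ))).prod (liouville d) with hμ
  set g : ℝ × UnitBundle d → ℂ := fun q => (-(q.1 : ℂ)) ^ k * Complex.exp (-s * q.1) with hg
  have hg1 : Integrable g μ := by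
    have := integrable_prod_laplace (d := d) k hs (G := fun _ => 1) continuous_const
      (C := 1) (by simp)
    simp only [mul_one] at this
    exact this
  have hint : ∀ n : Fin d → ℤ, Integrable (fun q => g q * movingMode n φ ψ q) μ := fun n =>
    integrable_prod_laplace k hs (continuous_movingMode n φ ψ)
      fun q => (norm_movingMode n φ ψ q).trans_le (norm_mode_le 0 n φ ψ q.2)
  have hsum : Summable fun n : Fin d → ℤ => ∫ q, ‖g q * movingMode n φ ψ q‖ ∂μ := by
    refine Summable.of_nonneg_of_le (fun n => integral_nonneg fun _ => norm_nonneg _) (fun n => ?_)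
      ((((summable_freq d (by have := NeZero.pos d; omega)).mul_right
        (cnorm 0 (oneSubLaplacian^[d] φ))).mul_right (cnorm 0 ψ)).mul_left (∫ q, ‖g q‖ ∂μ))
    rw [← integral_mul_const]
    refine integral_mono (hint n).norm (hg1.norm.mul_const _) fun q => ?_
    simp only
    rw [norm_mul, norm_movingMode]
    gcongr
    exact norm_mode_le d n φ ψ q.2
  have h := hasSum_integral_of_summable_integral_norm hint hsum
  have htsum : ∀ q : ℝ × UnitBundle d, ∑' n, g q * movingMode n φ ψ q =
      g q * ((transport q.1 φ).1 q.2 * ψ.1 q.2) :=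
    fun q => ((hasSum_movingMode φ ψ q.1 q.2).mul_left _).tsum_eq
  rw [integral_congr_ae (.of_forall htsum)] at h
  simp only [hg, hμ, integral_movingMode k hs] at h
  have hG : Continuous fun q : ℝ × UnitBundle d => (transport q.1 φ).1 q.2 * ψ.1 q.2 := by
    have h1 : Continuous fun q : ℝ × UnitBundle d => flow (-q.1) q.2 :=
      continuous_flow.comp (continuous_fst.neg.prodMk continuous_snd)
    exact (φ.continuous.comp h1).mul (ψ.continuous.comp continuous_snd)
  rw [integral_prod _ (integrable_prod_laplace k hs hG (C := cnorm 0 φ * cnorm 0 ψ) fun q => by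
    rw [norm_mul]
    exact mul_le_mul (norm_le_cnorm 0 φ _) (norm_le_cnorm 0 ψ _) (norm_nonneg _)
      (cnorm_nonneg _ _))] at h
  simp only [integral_const_mul] at h
  exact h

end Laplace

/-! ### Bounds for one frequency and their summation -/

section ModeBound

open MeasureTheory Filter Topology Set

variable {d : ℕ}

theorem continuous_invKernel_sphere (m : ℕ) {s : ℂ} (hs : 0 < s.re) (ξ : E d) :
    Continuous fun θ : Sph d => invKernel m (symb s ξ (θ : E d)) :=
  continuous_iff_continuousAt.2 fun θ =>
    (continuousAt_invKernel_symb m hs ξ (sphere_ne_zero θ)).comp continuous_subtype_val.continuousAt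

theorem dir_dir {v : E d} (hv : v ≠ 0) : dir (dir v) = dir v := by
  have h := norm_dir hv
  rw [dir, h, inv_one, one_smul]

variable [NeZero d]

instance nontrivial_euclidean : Nontrivial (E d) :=
  haveI : Nonempty (Fin d) := ⟨0⟩
  inferInstance

/-- The integral over the sphere of the symbol against two smooth functions is an oscillatory
integral over the annulus. -/
theorem exists_integral_sphere_eq_oscInt : ∃ κ : ℂ, ∀ (m : ℕ) (s : ℂ) (ξ : E d) (φ ψ : SmoothFn d)
    (x y : E d),
    ∫ θ : Sph d, φ.1 (proj x, θ) * (ψ.1 (proj y, θ) * invKernel m (symb s ξ (θ : E d)))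
      ∂((volume : Measure (E d)).toSphere) =
    κ * oscInt m s ξ (fun v => rayExt φ.1 (x, v) * (rayExt ψ.1 (y, v) * cutoff v)) := by
  obtain ⟨κ, hκ⟩ := exists_integral_sphere_eq (E := E d)
  refine ⟨κ, fun m s ξ φ ψ x y => ?_⟩
  have hray : ∀ (φ : SmoothFn d) (x v : E d), v ≠ 0 →
      rayExt φ.1 (x, dir v) = rayExt φ.1 (x, v) := fun φ x v hv =>
    rayExt_smul φ.1 (inv_pos.2 (norm_pos_iff.2 hv)) x v
  -- All three factors are constant on rays, so the passage from the sphere to the annulus applies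
  -- to their product.
  have h := hκ (fun v => rayExt φ.1 (x, v) * (rayExt ψ.1 (y, v) * invKernel m (symb s ξ v)))
    fun v hv => by
      simp only [hray _ _ v hv]
      simp only [symb, phase, dir_dir hv]
  simp only [rayExt_sphere] at h
  rw [h, oscInt]
  congr 1
  refine integral_congr_ae (.of_forall fun v => ?_)
  simp only
  ring

/-- Unfolding the Fourier coefficient and integrating in `θ` first leaves the amplitude `φ(y, θ)
ψ(x, θ)` for fixed `x` and `y`; no derivative of a Fourier coefficient in `θ` is ever needed. -/
theorem modeInt_eq (m : ℕ) {s : ℂ} (hs : 0 < s.re) (n : Fin d → ℤ) (φ ψ : SmoothFn d) :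
    modeInt m s n φ ψ = ∫ x, ∫ y, torusChar n x * torusChar (-n) y *
      ∫ θ : Sph d, φ.1 (y, θ) * (ψ.1 (x, θ) * invKernel m (symb s (freq n) (θ : E d)))
        ∂((volume : Measure (E d)).toSphere) ∂(torusHaar d) := by
  have hW := continuous_invKernel_sphere m hs (freq n)
  have hint : Integrable (fun p : UnitBundle d => invKernel m (symb s (freq n) (p.2 : E d)) *
      mode n φ ψ p) (liouville d) :=
    integrable_liouville ((hW.comp continuous_snd).mul (continuous_mode n φ ψ))
  unfold modeInt
  unfold liouville at *
  rw [integral_prod _ hint]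
  refine integral_congr_ae (.of_forall fun x => ?_)
  simp only
  have hG : Continuous fun q : Sph d × Torus d => torusChar n x * torusChar (-n) q.2 *
      (φ.1 (q.2, q.1) * (ψ.1 (x, q.1) * invKernel m (symb s (freq n) (q.1 : E d)))) := by
    refine (continuous_const.mul ((continuous_torusChar (-n)).comp continuous_snd)).mul ?_
    refine (φ.continuous.comp (continuous_snd.prodMk continuous_fst)).mul ?_
    exact (ψ.continuous.comp (continuous_const.prodMk continuous_fst)).mul (hW.comp continuous_fst)
  have hswap := integral_integral_swap (μ := (volume : Measure (E d)).toSphere)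
    (ν := torusHaar d) (f := fun (θ : Sph d) (y : Torus d) => torusChar n x * torusChar (-n) y *
      (φ.1 (y, θ) * (ψ.1 (x, θ) * invKernel m (symb s (freq n) (θ : E d)))))
    (hG.integrable_of_hasCompactSupport (HasCompactSupport.of_compactSpace _))
  simp only [integral_const_mul] at hswap
  rw [← hswap]
  refine integral_congr_ae (.of_forall fun θ => ?_)
  simp only [mode, fcoeff]
  rw [← integral_mul_const, ← integral_mul_const, ← integral_const_mul]
  refine integral_congr_ae (.of_forall fun y => ?_)
  simp only
  ring

theorem exists_bound_modeInt (d : ℕ) [NeZero d] (m : ℕ) : ∃ C : ℝ, 0 ≤ C ∧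
    ∀ (s : ℂ) (n : Fin d → ℤ) (φ ψ : SmoothFn d), 0 < s.re →
      ‖s ^ 2 + (‖freq n‖ : ℂ) ^ 2‖ ^ m * ‖modeInt m s n φ ψ‖ ≤
        C * (1 + ‖s‖ + ‖freq n‖) ^ (2 * m + 2) * cnorm m φ * cnorm m ψ := by
  obtain ⟨κ, hκ⟩ := exists_integral_sphere_eq_oscInt (d := d)
  obtain ⟨C, hC0, hC⟩ := exists_bound_oscInt (E := E d) m
  obtain ⟨c, hc0, hc⟩ := exists_isAmplitude_rayExt (d := d) m
  refine ⟨‖κ‖ * (C * c) * (volume : Measure (Torus d)).real univ, by positivity,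
    fun s n φ ψ hs => ?_⟩
  set q := ‖s ^ 2 + (‖freq n‖ : ℂ) ^ 2‖ with hq
  set X := (1 + ‖s‖ + ‖freq n‖) ^ (2 * m + 2) with hX
  set J : Torus d → Torus d → ℂ := fun x y =>
    ∫ θ : Sph d, φ.1 (y, θ) * (ψ.1 (x, θ) * invKernel m (symb s (freq n) (θ : E d)))
      ∂((volume : Measure (E d)).toSphere) with hJ
  have hJb : ∀ x y, ‖((q ^ m : ℝ) : ℂ) * J x y‖ ≤ ‖κ‖ * (C * c) * X * cnorm m φ * cnorm m ψ := by
    intro x y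
    obtain ⟨x, rfl⟩ := surjective_proj x
    obtain ⟨y, rfl⟩ := surjective_proj y
    have hJxy : J (proj x) (proj y) = _ := hκ m s (freq n) φ ψ y x
    rw [hJxy, norm_mul, Complex.norm_real, Real.norm_of_nonneg (by positivity), norm_mul]
    have h := hC s (freq n) _ _ hs (hc φ ψ y x)
    calc _ = ‖κ‖ * (q ^ m * ‖oscInt m s (freq n)
          (fun v => rayExt φ.1 (y, v) * (rayExt ψ.1 (x, v) * cutoff v))‖) := by ring
      _ ≤ ‖κ‖ * (C * X * (c * cnorm m φ * cnorm m ψ)) := by gcongr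
      _ = _ := by ring
  have h1 : ‖((q ^ m : ℝ) : ℂ) * modeInt m s n φ ψ‖ ≤
      ‖κ‖ * (C * c) * X * cnorm m φ * cnorm m ψ * (volume : Measure (Torus d)).real univ := by
    rw [modeInt_eq m hs, ← integral_const_mul]
    refine norm_integral_le_of_norm_le_const (.of_forall fun x => ?_)
    rw [← integral_const_mul]
    have h2 := norm_integral_le_of_norm_le_const (μ := torusHaar d)
      (f := fun y => ((q ^ m : ℝ) : ℂ) * (torusChar n x * torusChar (-n) y * J x y))
      (C := ‖κ‖ * (C * c) * X * cnorm m φ * cnorm m ψ) (.of_forall fun y => by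
        rw [mul_left_comm, norm_mul, norm_mul, norm_torusChar, norm_torusChar, one_mul, one_mul]
        exact hJb x y)
    simpa using h2
  rw [norm_mul, Complex.norm_real, Real.norm_of_nonneg (by positivity)] at h1
  refine h1.trans (le_of_eq (by ring))

theorem modeInt_eq_inv_mul (M m : ℕ) (s : ℂ) (n : Fin d → ℤ) (φ ψ : SmoothFn d) :
    modeInt m s n φ ψ =
      (((1 + ‖freq n‖ ^ 2) ^ M : ℝ) : ℂ)⁻¹ * modeInt m s n (oneSubLaplacian^[M] φ) ψ := by
  unfold modeInt
  rw [← integral_const_mul]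
  refine integral_congr_ae (.of_forall fun p => ?_)
  simp only [mode]
  rw [fcoeff_eq M n φ]
  ring

theorem pow_one_add_add_le (k : ℕ) {x σ R : ℝ} (hx : 0 ≤ x) (hσ : 0 ≤ σ) (hR : σ ≤ R) :
    (1 + σ + x) ^ (2 * (k + 2) + 2) ≤
      (|R| + 1) ^ (2 * k + 6) * (2 ^ (k + 3) * (1 + x ^ 2) ^ (k + 3)) := by
  have e1 : 1 + σ + x ≤ (|R| + 1) * (1 + x) := by
    have := hR.trans (le_abs_self R)
    nlinarith [abs_nonneg R]
  have e2 : (1 + x) ^ 2 ≤ 2 * (1 + x ^ 2) := by nlinarith [sq_nonneg (x - 1)]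
  calc (1 + σ + x) ^ (2 * (k + 2) + 2) ≤ ((|R| + 1) * (1 + x)) ^ (2 * (k + 2) + 2) := by gcongr
    _ = (|R| + 1) ^ (2 * k + 6) * ((1 + x) ^ 2) ^ (k + 3) := by
        rw [mul_pow, ← pow_mul]; congr 2
    _ ≤ (|R| + 1) ^ (2 * k + 6) * (2 * (1 + x ^ 2)) ^ (k + 3) := by gcongr
    _ = _ := by rw [mul_pow]

theorem le_inv_mul_of_mul_le {δ q I C Y Z c₁ c₂ A B : ℝ} (hδ : 0 < δ) (hq : δ ≤ q)
    (h : q * I ≤ C * Y * c₁ * c₂) (hY : Y ≤ Z) (h₁ : c₁ ≤ A) (h₂ : c₂ ≤ B) (hI : 0 ≤ I)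
    (hC : 0 ≤ C) (hc₁ : 0 ≤ c₁) (hc₂ : 0 ≤ c₂) (hY0 : 0 ≤ Y) :
    I ≤ δ⁻¹ * (C * Z * A * B) := by
  rw [le_inv_mul_iff₀ hδ]
  refine (mul_le_mul_of_nonneg_right hq hI).trans (h.trans ?_)
  have := hY0.trans hY
  have := hc₁.trans h₁
  gcongr

/-- Uniform bound for the derivatives of the resolvent in the open half-plane. -/
theorem exists_bound_resolventDeriv (d : ℕ) [NeZero d] (k : ℕ) {δ : ℝ} (hδ : 0 < δ) (R : ℝ) :
    ∃ (N : ℕ) (C : ℝ), 0 ≤ C ∧ ∀ (s : ℂ) (φ ψ : SmoothFn d), 0 < s.re → ‖s‖ ≤ R →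
      (∀ n : Fin d → ℤ, δ ≤ ‖s ^ 2 + (‖freq n‖ : ℂ) ^ 2‖) →
      ‖resolventDeriv φ ψ k s‖ ≤ C * cnorm N φ * cnorm N ψ := by
  obtain ⟨C, hC0, hC⟩ := exists_bound_modeInt d (k + 2)
  have hsum := summable_freq (d := d) d (by have := NeZero.pos d; omega)
  -- Of these powers of `(1 + ‖ξ‖²)⁻¹`, `k + 3` absorb the growth `‖ξ‖^{2k+6}` of the bound for one
  -- frequency and `d` make the lattice sum converge. Each power costs two derivatives, whence the
  -- order `k + 2 + 2 * M` below.
  set M := k + 3 + d with hM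
  set S := ∑' n : Fin d → ℤ, ((1 + ‖freq n‖ ^ 2) ^ d)⁻¹ with hS
  have hS0 : 0 ≤ S := tsum_nonneg fun n => by positivity
  set D := (δ ^ (k + 2))⁻¹ * C * (|R| + 1) ^ (2 * k + 6) * 2 ^ (k + 3) * (1 + d) ^ M with hD
  have hD0 : 0 ≤ D := by positivity
  refine ⟨k + 2 + 2 * M, D * S, by positivity, fun s φ ψ hs hsR hδs => ?_⟩
  set A := cnorm (k + 2 + 2 * M) φ with hA
  set B := cnorm (k + 2 + 2 * M) ψ with hB
  have hA0 : 0 ≤ A := cnorm_nonneg _ _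
  have hB0 : 0 ≤ B := cnorm_nonneg _ _
  have hterm : ∀ n : Fin d → ℤ,
      ‖modeInt (k + 2) s n φ ψ‖ ≤ ((1 + ‖freq n‖ ^ 2) ^ d)⁻¹ * (D * A * B) := by
    intro n
    set x := ‖freq n‖ with hx
    have hx0 : 0 ≤ x := norm_nonneg _
    have h1 := hC s n (oneSubLaplacian^[M] φ) ψ hs
    have h2 : cnorm (k + 2) (oneSubLaplacian^[M] φ) ≤ (1 + d) ^ M * A :=
      cnorm_iterate_oneSubLaplacian_le M (k + 2) φ
    have h3 : cnorm (k + 2) ψ ≤ B := cnorm_mono (by omega) ψ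
    have h4 : δ ^ (k + 2) ≤ ‖s ^ 2 + (x : ℂ) ^ 2‖ ^ (k + 2) := pow_le_pow_left₀ hδ.le (hδs n) _
    have h5 : (1 + ‖s‖ + x) ^ (2 * (k + 2) + 2) ≤
        (|R| + 1) ^ (2 * k + 6) * (2 ^ (k + 3) * (1 + x ^ 2) ^ (k + 3)) :=
      pow_one_add_add_le k hx0 (norm_nonneg s) hsR
    rw [modeInt_eq_inv_mul M, norm_mul, norm_inv, Complex.norm_real,
      Real.norm_of_nonneg (by positivity)]
    set I := ‖modeInt (k + 2) s n (oneSubLaplacian^[M] φ) ψ‖ with hI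
    have h6 : I ≤ (δ ^ (k + 2))⁻¹ * (C * ((|R| + 1) ^ (2 * k + 6) *
        (2 ^ (k + 3) * (1 + x ^ 2) ^ (k + 3))) * ((1 + d) ^ M * A) * B) :=
      le_inv_mul_of_mul_le (pow_pos hδ _) h4 h1 h5 h2 h3 (norm_nonneg _) hC0
        (cnorm_nonneg _ _) (cnorm_nonneg _ _) (by positivity)
    calc _ ≤ ((1 + x ^ 2) ^ M)⁻¹ * ((δ ^ (k + 2))⁻¹ * (C * ((|R| + 1) ^ (2 * k + 6) *
        (2 ^ (k + 3) * (1 + x ^ 2) ^ (k + 3))) * ((1 + d) ^ M * A) * B)) :=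
          mul_le_mul_of_nonneg_left h6 (by positivity)
      _ = ((1 + x ^ 2) ^ M)⁻¹ * (1 + x ^ 2) ^ (k + 3) * (D * A * B) := by rw [hD]; ring
      _ = _ := by
        have : (1 + x ^ 2) ^ (k + 3) ≠ 0 := by positivity
        rw [hM, pow_add, mul_inv, mul_comm ((1 + x ^ 2) ^ (k + 3))⁻¹, mul_assoc _ _ ((1 + x ^ 2) ^ _),
          inv_mul_cancel₀ this, mul_one]
  have hs1 := hsum.mul_right (D * A * B)
  have h := tsum_of_norm_bounded hs1.hasSum hterm
  rw [(hasSum_modeInt k hs φ ψ).tsum_eq, tsum_mul_right] at h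
  refine h.trans (le_of_eq (by ring))

end ModeBound

/-! ### The singular set and uniform nonresonance -/

section Spectrum

open Filter Topology Set

variable {d : ℕ}

theorem laplacian_cexp_inner (ξ x : E d) :
    Laplacian.laplacian (fun y : E d => Complex.exp (Complex.I * (inner ℝ ξ y : ℝ))) x =
      -((‖ξ‖ ^ 2 : ℝ) : ℂ) * Complex.exp (Complex.I * (inner ℝ ξ x : ℝ)) := by
  let ℓ : E d →L[ℝ] ℂ := Complex.I • (Complex.ofRealCLM ∘L innerSL ℝ ξ)
  have hℓ : ∀ y, ℓ y = Complex.I * (inner ℝ ξ y : ℝ) := fun y => rfl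
  simp only [← hℓ]
  have h1 : ∀ y, HasFDerivAt (fun y => Complex.exp (ℓ y)) (Complex.exp (ℓ y) • ℓ) y :=
    fun y => ℓ.hasFDerivAt.cexp
  have h2 : fderiv ℝ (fun y => Complex.exp (ℓ y)) = fun y => Complex.exp (ℓ y) • ℓ :=
    funext fun y => (h1 y).fderiv
  have h3 : ∀ v, fderiv ℝ (fderiv ℝ fun y => Complex.exp (ℓ y)) x v v =
      Complex.exp (ℓ x) * -((inner ℝ v ξ ^ 2 : ℝ) : ℂ) := by
    intro v
    rw [h2, ((h1 x).smul_const ℓ).fderiv]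
    have hI := Complex.I_sq
    simp only [ContinuousLinearMap.smulRight_apply, smul_apply, smul_eq_mul, hℓ,
      real_inner_comm v ξ]
    push_cast
    linear_combination Complex.exp (Complex.I * (inner ℝ ξ x : ℝ)) * (inner ℝ v ξ : ℝ) ^ 2 * hI
  have h4 := OrthonormalBasis.sum_sq_norm_inner_right (EuclideanSpace.basisFun (Fin d) ℝ) ξ
  rw [InnerProductSpace.laplacian_eq_iteratedFDeriv_orthonormalBasis _
    (EuclideanSpace.basisFun (Fin d) ℝ)]
  simp only [iteratedFDeriv_two_apply, Matrix.cons_val_zero, Matrix.cons_val_one, h3]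
  rw [← h4, ← Finset.mul_sum, Finset.sum_neg_distrib, mul_comm]
  simp

/-- The characters are eigenfunctions. Only this inclusion is needed: it ensures that avoiding the
singular set rules out every resonance `s² + ‖ξ‖² = 0`. -/
theorem norm_freq_mem_spSqrtLaplacian (n : Fin d → ℤ) : ‖freq n‖ ∈ spSqrtLaplacian d := by
  refine ⟨norm_nonneg _, torusChar n, ?_, ?_, fun x => ?_⟩
  · intro h
    have := norm_torusChar n (0 : Torus d)
    simp [h] at this
  · simp only [torusChar_proj]
    exact (contDiff_const.mul (Complex.ofRealCLM.contDiff.comp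
      (contDiff_const.inner ℝ contDiff_id))).cexp
  · simp only [torusChar_proj, laplacian_cexp_inner]
    ring

theorem sq_add_norm_freq_sq_ne_zero {s : ℂ} (hs : s ∉ singularSet d) (n : Fin d → ℤ) :
    s ^ 2 + (‖freq n‖ : ℂ) ^ 2 ≠ 0 := by
  intro h
  refine hs ⟨‖freq n‖, norm_freq_mem_spSqrtLaplacian n, ?_⟩
  have h1 : (s - Complex.I * ‖freq n‖) * (s + Complex.I * ‖freq n‖) = 0 := by
    linear_combination h - (‖freq n‖ : ℂ) ^ 2 * Complex.I_sq
  rcases mul_eq_zero.mp h1 with h2 | h2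
  · exact Or.inl (by linear_combination h2)
  · exact Or.inr (by linear_combination h2)

theorem re_eq_zero_of_mem_singularSet {s : ℂ} (hs : s ∈ singularSet d) : s.re = 0 := by
  obtain ⟨lam, -, rfl | rfl⟩ := hs <;> simp

/-- The resonance condition holds uniformly near a compact set avoiding the singular set. -/
theorem exists_nonresonance_of_isCompact {K : Set ℂ} (hK : IsCompact K)
    (hs : ∀ s ∈ K, s ∉ singularSet d) :
    ∃ δ R : ℝ, 0 < δ ∧ ∀ s ∈ K, ∀ᶠ z in 𝓝 s,
      ‖z‖ ≤ R ∧ ∀ n : Fin d → ℤ, δ ≤ ‖z ^ 2 + (‖freq n‖ : ℂ) ^ 2‖ := by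
  let Z : Set ℂ := range fun n : Fin d → ℤ => -(‖freq n‖ : ℂ) ^ 2
  -- The squared norms of the frequencies are integers, so `Z` is the image of a subset of `ℤ`,
  -- which is closed in `ℂ`. This turns the absence of resonances into a positive distance.
  have hZ : IsClosed Z := by
    have h : Z = (Int.cast : ℤ → ℂ) '' range fun n : Fin d → ℤ => -∑ i, n i ^ 2 := by
      rw [← range_comp]
      refine congrArg range (funext fun n => ?_)
      rw [Function.comp_apply, ← Complex.ofReal_pow, norm_freq_sq]
      push_cast
      rfl
    rw [h]
    exact Complex.isClosedEmbedding_intCast.isClosedMap _ (isClosed_discrete _)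
  have hZne : Z.Nonempty := range_nonempty _
  have hcont : Continuous fun s : ℂ => Metric.infDist (s ^ 2) Z :=
    (Metric.continuous_infDist_pt Z).comp (continuous_pow 2)
  obtain ⟨R, hR⟩ := hK.isBounded.exists_norm_le
  have hpos : ∀ s ∈ K, 0 < Metric.infDist (s ^ 2) Z := by
    intro s hsK
    refine (hZ.notMem_iff_infDist_pos hZne).mp ?_
    rintro ⟨n, hn⟩
    exact sq_add_norm_freq_sq_ne_zero (hs s hsK) n (by simp only at hn; rw [← hn]; ring)
  obtain ⟨δ, hδ, hδK⟩ : ∃ δ > 0, ∀ s ∈ K, δ < Metric.infDist (s ^ 2) Z := by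
    rcases K.eq_empty_or_nonempty with rfl | hne
    · exact ⟨1, one_pos, by simp⟩
    · obtain ⟨s₀, hs₀, hmin⟩ := hK.exists_isMinOn hne hcont.continuousOn
      exact ⟨Metric.infDist (s₀ ^ 2) Z / 2, half_pos (hpos s₀ hs₀), fun s hsK =>
        (half_lt_self (hpos s₀ hs₀)).trans_le (hmin hsK)⟩
  refine ⟨δ, R + 1, hδ, fun s hsK => ?_⟩
  have h1 : ∀ᶠ z in 𝓝 s, δ < Metric.infDist (z ^ 2) Z :=
    hcont.continuousAt.eventually_const_lt (hδK s hsK)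
  have h2 : ∀ᶠ z in 𝓝 s, ‖z‖ < R + 1 :=
    continuous_norm.continuousAt.eventually_lt_const ((hR s hsK).trans_lt (lt_add_one R))
  filter_upwards [h1, h2] with z hz1 hz2
  refine ⟨hz2.le, fun n => hz1.le.trans ?_⟩
  have h := Metric.infDist_le_dist_of_mem (x := z ^ 2) (mem_range_self n : _ ∈ Z)
  rwa [dist_eq_norm, sub_neg_eq_add] at h

/-- The closed half plane with the singular set removed. -/
def regularSet (d : ℕ) : Set ℂ := {s : ℂ | 0 ≤ s.re} \ singularSet d

theorem regularSet_subset : regularSet d ⊆ {s : ℂ | 0 ≤ s.re} := sdiff_subset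

theorem rightHalfPlane_subset_regularSet : rightHalfPlane ⊆ regularSet d := by
  intro s (hs : 0 < s.re)
  exact ⟨hs.le, fun h => hs.ne' (re_eq_zero_of_mem_singularSet h)⟩

end Spectrum

/-! ### The extended resolvent and its equation -/

section Extension

open MeasureTheory Filter Topology Set

variable {d : ℕ} [NeZero d]

theorem exists_bound_near_compact {K : Set ℂ} (hKΩ : K ⊆ regularSet d) (hK : IsCompact K) (k : ℕ) :
    ∃ (N : ℕ) (C : ℝ), 0 ≤ C ∧ ∀ s ∈ K, ∀ φ ψ : SmoothFn d,
      ∀ᶠ z in 𝓝[rightHalfPlane] s, ‖resolventDeriv φ ψ k z‖ ≤ C * cnorm N φ * cnorm N ψ := by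
  obtain ⟨δ, R, hδ, h⟩ := exists_nonresonance_of_isCompact hK fun s hs => (hKΩ hs).2
  obtain ⟨N, C, hC, hb⟩ := exists_bound_resolventDeriv d k hδ R
  refine ⟨N, C, hC, fun s hs φ ψ => ?_⟩
  filter_upwards [(h s hs).filter_mono nhdsWithin_le_nhds, self_mem_nhdsWithin] with z hz hz0
  exact hb z φ ψ hz0 hz.1 hz.2

theorem boundedNear_resolventDeriv (φ ψ : SmoothFn d) {s : ℂ} (hs : s ∈ regularSet d) (k : ℕ) :
    BoundedNear (resolventDeriv φ ψ k) s := by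
  obtain ⟨N, C, hC, h⟩ := exists_bound_near_compact (singleton_subset_iff.mpr hs)
    isCompact_singleton k
  refine ⟨(C * cnorm N φ * cnorm N ψ).toNNReal, (h s rfl φ ψ).mono fun z hz => ?_⟩
  rw [← norm_toNNReal]
  exact Real.toNNReal_le_toNNReal hz

theorem tendsto_resolventDeriv (φ ψ : SmoothFn d) {s : ℂ} (hs : s ∈ regularSet d) :
    Tendsto (resolventDeriv φ ψ 0) (𝓝[rightHalfPlane] s)
      (𝓝 (boundaryExt (resolventDeriv φ ψ) 0 s)) :=
  tendsto_boundaryExt (isDerivChain_resolventDeriv φ ψ) 0 hs.1 (boundedNear_resolventDeriv φ ψ hs 1)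

theorem integrableOn_resolvent (φ ψ : SmoothFn d) {s : ℂ} (hs : 0 < s.re) :
    IntegrableOn (fun t : ℝ => Complex.exp (-s * t) * pairing (transport t φ).1 ψ.1) (Ioi 0) := by
  obtain ⟨B, hB⟩ := exists_bound_pairing_transport φ ψ
  simpa using integrableOn_laplace 0 hs (continuous_pairing_transport φ ψ) hB

theorem resolventDeriv_zero (φ ψ : SmoothFn d) (s : ℂ) : resolventDeriv φ ψ 0 s =
    ∫ t in Ioi (0 : ℝ), Complex.exp (-s * t) * pairing (transport t φ).1 ψ.1 := by
  simp [resolventDeriv]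

theorem resolventDeriv_add_left (φ φ' ψ : SmoothFn d) {s : ℂ} (hs : 0 < s.re) :
    resolventDeriv (φ + φ') ψ 0 s = resolventDeriv φ ψ 0 s + resolventDeriv φ' ψ 0 s := by
  simp only [resolventDeriv_zero]
  rw [← integral_add (integrableOn_resolvent φ ψ hs) (integrableOn_resolvent φ' ψ hs)]
  congr 1 with t
  rw [transport_add, pairing_add_left, mul_add]

theorem resolventDeriv_add_right (φ ψ ψ' : SmoothFn d) {s : ℂ} (hs : 0 < s.re) :
    resolventDeriv φ (ψ + ψ') 0 s = resolventDeriv φ ψ 0 s + resolventDeriv φ ψ' 0 s := by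
  simp only [resolventDeriv_zero]
  rw [← integral_add (integrableOn_resolvent φ ψ hs) (integrableOn_resolvent φ ψ' hs)]
  congr 1 with t
  rw [pairing_add_right, mul_add]

theorem resolventDeriv_smul_left (c : ℂ) (φ ψ : SmoothFn d) (s : ℂ) :
    resolventDeriv (c • φ) ψ 0 s = c * resolventDeriv φ ψ 0 s := by
  simp only [resolventDeriv_zero]
  rw [← integral_const_mul]
  congr 1 with t
  rw [transport_smul, pairing_smul_left]
  ring

theorem resolventDeriv_smul_right (c : ℂ) (φ ψ : SmoothFn d) (s : ℂ) :
    resolventDeriv φ (c • ψ) 0 s = c * resolventDeriv φ ψ 0 s := by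
  simp only [resolventDeriv_zero]
  rw [← integral_const_mul]
  congr 1 with t
  rw [pairing_smul_right]
  ring

theorem neBot_rightHalfPlane {s : ℂ} (hs : 0 ≤ s.re) : (𝓝[rightHalfPlane] s).NeBot :=
  mem_closure_iff_nhdsWithin_neBot.mp (by rw [closure_rightHalfPlane]; exact hs)

/-- The extended resolvent at a regular point, as a bilinear form on smooth functions. -/
def resolventForm {s : ℂ} (hs : s ∈ regularSet d) :
    SmoothFn d →ₗ[ℂ] SmoothFn d →ₗ[ℂ] ℂ :=
  haveI := neBot_rightHalfPlane hs.1
  LinearMap.mk₂ ℂ (fun φ ψ => boundaryExt (resolventDeriv φ ψ) 0 s)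
    -- Bilinearity holds for `Re s > 0`, where the integrals converge, and passes to boundary points
    -- by uniqueness of limits.
    (fun φ φ' ψ => tendsto_nhds_unique (tendsto_resolventDeriv (φ + φ') ψ hs)
      (((tendsto_resolventDeriv φ ψ hs).add (tendsto_resolventDeriv φ' ψ hs)).congr'
        (eventually_mem_nhdsWithin.mono fun _ hz => (resolventDeriv_add_left φ φ' ψ hz).symm)))
    (fun c φ ψ => tendsto_nhds_unique (tendsto_resolventDeriv (c • φ) ψ hs)
      (((tendsto_resolventDeriv φ ψ hs).const_mul c).congr
        fun z => (resolventDeriv_smul_left c φ ψ z).symm))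
    (fun φ ψ ψ' => tendsto_nhds_unique (tendsto_resolventDeriv φ (ψ + ψ') hs)
      (((tendsto_resolventDeriv φ ψ hs).add (tendsto_resolventDeriv φ ψ' hs)).congr'
        (eventually_mem_nhdsWithin.mono fun _ hz => (resolventDeriv_add_right φ ψ ψ' hz).symm)))
    (fun c φ ψ => tendsto_nhds_unique (tendsto_resolventDeriv φ (c • ψ) hs)
      (((tendsto_resolventDeriv φ ψ hs).const_mul c).congr
        fun z => (resolventDeriv_smul_right c φ ψ z).symm))

theorem norm_boundaryExt_resolventDeriv_le {K : Set ℂ} (hKΩ : K ⊆ regularSet d) (hK : IsCompact K)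
    (k : ℕ) : ∃ (N : ℕ) (C : ℝ), 0 ≤ C ∧ ∀ s ∈ K, ∀ φ ψ : SmoothFn d,
      ‖boundaryExt (resolventDeriv φ ψ) k s‖ ≤ C * cnorm N φ * cnorm N ψ := by
  obtain ⟨N, C, hC, h⟩ := exists_bound_near_compact hKΩ hK k
  exact ⟨N, C, hC, fun s hs φ ψ => norm_boundaryExt_le (isDerivChain_resolventDeriv φ ψ) k
    (hKΩ hs).1 (boundedNear_resolventDeriv φ ψ (hKΩ hs) (k + 1)) (h s hs φ ψ)⟩

theorem resolventForm_mem_distributions {s : ℂ} (hs : s ∈ regularSet d) (φ : SmoothFn d) :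
    resolventForm hs φ ∈ distributions d := by
  obtain ⟨N, C, hC, h⟩ := norm_boundaryExt_resolventDeriv_le (singleton_subset_iff.mpr hs)
    isCompact_singleton 0
  refine ⟨N, (C * cnorm N φ).toNNReal, fun ψ => ?_⟩
  rw [← ofReal_norm, ← ofReal_cnorm, ← ENNReal.ofReal,
    ← ENNReal.ofReal_mul (mul_nonneg hC (cnorm_nonneg N φ))]
  exact ENNReal.ofReal_le_ofReal (h s rfl φ ψ)

open Classical in
/-- The resolvent of the geodesic vector field, extended to the regular points of the boundary of
the half plane. -/
def resolvent (d : ℕ) [NeZero d] (s : ℂ) : SmoothFn d →ₗ[ℂ] Distribution d :=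
  if hs : s ∈ regularSet d then
    LinearMap.codRestrict (distributions d) (resolventForm hs) (resolventForm_mem_distributions hs)
  -- A default value at points outside the regular set, about which nothing is claimed.
  else 0

theorem resolvent_apply {s : ℂ} (hs : s ∈ regularSet d) (φ ψ : SmoothFn d) :
    (resolvent d s φ).1 ψ = boundaryExt (resolventDeriv φ ψ) 0 s := by
  rw [resolvent, dif_pos hs]
  rfl

theorem resolvent_apply_of_re_pos {s : ℂ} (hs : 0 < s.re) (φ ψ : SmoothFn d) :
    (resolvent d s φ).1 ψ =
      ∫ t in Ioi (0 : ℝ), Complex.exp (-s * t) * pairing (transport t φ).1 ψ.1 := by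
  rw [resolvent_apply (rightHalfPlane_subset_regularSet hs),
    boundaryExt_of_mem (isDerivChain_resolventDeriv φ ψ) 0 hs, resolventDeriv_zero]

/-- The combined integrand is the derivative of `-e^{-st}⟨e^{-tV*}φ, ψ⟩`, which vanishes at infinity
and equals `-⟨φ, ψ⟩` at `t = 0`. -/
theorem resolvent_geodesicV_add {s : ℂ} (hs : 0 < s.re) (φ ψ : SmoothFn d) :
    (resolvent d s (geodesicV φ)).1 ψ + s * (resolvent d s φ).1 ψ = pairing φ.1 ψ.1 := by
  obtain ⟨B, hB⟩ := exists_bound_pairing_transport φ ψ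
  simp only [resolvent_apply_of_re_pos hs]
  rw [← integral_const_mul, ← integral_add (integrableOn_resolvent _ ψ hs)
    ((integrableOn_resolvent φ ψ hs).const_mul s)]
  have hd : ∀ t ∈ Ici (0 : ℝ), HasDerivAt
      (fun t : ℝ => -(Complex.exp (-s * t) * pairing (transport t φ).1 ψ.1))
      (Complex.exp (-s * t) * pairing (transport t (geodesicV φ)).1 ψ.1 +
        s * (Complex.exp (-s * t) * pairing (transport t φ).1 ψ.1)) t := by
    intro t _
    have h1 : HasDerivAt (fun t : ℝ => -s * (t : ℂ)) (-s) t := by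
      simpa using (HasDerivAt.ofReal_comp (hasDerivAt_id t)).const_mul (-s)
    refine ((h1.cexp.mul (hasDerivAt_pairing_transport φ ψ t)).neg).congr_deriv ?_
    ring
  have hlim : Tendsto (fun t : ℝ => -(Complex.exp (-s * t) * pairing (transport t φ).1 ψ.1)) atTop
      (𝓝 0) := by
    refine squeeze_zero_norm (a := fun t : ℝ => Real.exp (-s.re * t) * B) (fun t => ?_) ?_
    · rw [norm_neg, norm_mul, Complex.norm_exp]
      simp only [Complex.mul_re, Complex.neg_re, Complex.neg_im, Complex.ofReal_re,
        Complex.ofReal_im, mul_zero, sub_zero]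
      gcongr
      exact hB t
    · rw [← zero_mul B]
      refine Tendsto.mul_const B (Real.tendsto_exp_atBot.comp ?_)
      exact tendsto_id.const_mul_atTop_of_neg (neg_lt_zero.mpr hs)
  rw [integral_Ioi_of_hasDerivAt_of_tendsto' hd ((integrableOn_resolvent _ ψ hs).add
    ((integrableOn_resolvent φ ψ hs).const_mul s)) hlim]
  simp [transport_zero]

theorem isSmoothFamilyOn_resolvent : IsSmoothFamilyOn (resolvent d) (regularSet d) := by
  have heq : ∀ φ ψ : SmoothFn d, EqOn (fun s => (resolvent d s φ).1 ψ)
      (boundaryExt (resolventDeriv φ ψ) 0) (regularSet d) := fun φ ψ s hs => resolvent_apply hs φ ψ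
  refine ⟨fun φ ψ => (contDiffOn_boundaryExt (isDerivChain_resolventDeriv φ ψ) regularSet_subset
    fun s hs k => boundedNear_resolventDeriv φ ψ hs k).congr (heq φ ψ), fun K hKΩ hK k => ?_⟩
  obtain ⟨N, C, hC, h⟩ := norm_boundaryExt_resolventDeriv_le hKΩ hK k
  refine ⟨N, C.toNNReal, fun s hs φ ψ => ?_⟩
  rw [iteratedFDerivWithin_congr (heq φ ψ) (hKΩ hs), ← ofReal_norm, ← ofReal_cnorm, ← ofReal_cnorm,
    ← ENNReal.ofReal, ← ENNReal.ofReal_mul hC,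
    ← ENNReal.ofReal_mul (mul_nonneg hC (cnorm_nonneg N φ))]
  exact ENNReal.ofReal_le_ofReal ((norm_iteratedFDerivWithin_boundaryExt_le
    (isDerivChain_resolventDeriv φ ψ) regularSet_subset rightHalfPlane_subset_regularSet
    (fun s hs k => boundedNear_resolventDeriv φ ψ hs k) k (hKΩ hs)).trans (h s hs φ ψ))

end Extension

end FlatTorus

end

theorem theorem3p2 (d : ℕ) [NeZero d] :
    ∃ L : ℂ → SmoothFn d →ₗ[ℂ] Distribution d,
      (∀ s : ℂ, 0 < s.re →
        (∀ φ ψ : SmoothFn d,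
          MeasureTheory.IntegrableOn
            (fun t : ℝ => Complex.exp (-s * t) * pairing (transport t φ).1 ψ.1) (Set.Ioi 0) ∧
          (L s φ).1 ψ =
            ∫ t in Set.Ioi (0 : ℝ), Complex.exp (-s * t) * pairing (transport t φ).1 ψ.1) ∧
        (∀ φ ψ : SmoothFn d, (L s (geodesicV φ + s • φ)).1 ψ = pairing φ.1 ψ.1) ∧
        (∀ φ ψ : SmoothFn d, (L s φ).1 (s • ψ - geodesicV ψ) = pairing φ.1 ψ.1)) ∧
      IsSmoothFamilyOn L ({s : ℂ | 0 ≤ s.re} \ singularSet d) := by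
  refine ⟨resolvent d, fun s hs => ⟨fun φ ψ => ⟨integrableOn_resolvent φ ψ hs,
    resolvent_apply_of_re_pos hs φ ψ⟩, fun φ ψ => ?_, fun φ ψ => ?_⟩, isSmoothFamilyOn_resolvent⟩
  · rw [map_add, map_smul, ← resolvent_geodesicV_add hs φ ψ]
    rfl
  -- On distributions `V + s` acts through its transpose `s - V`; antisymmetry of `V` under the time
  -- integral reduces this equation to the preceding one.
  · have hV : (resolvent d s φ).1 (geodesicV ψ) = -(resolvent d s (geodesicV φ)).1 ψ := by
      simp only [resolvent_apply_of_re_pos hs, pairing_transport_geodesicV, mul_neg,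
        MeasureTheory.integral_neg]
    rw [map_sub, map_smul, hV, ← resolvent_geodesicV_add hs φ ψ, smul_eq_mul]
    ring
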